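/- **Notation.** Let $K$ be a field of characteristic $0$ and let $q,s\in K$ with $q\ne0$, $q^2\neq1$, $q^4\ne1$, $q^6\ne1$ and $s^2=[3]_q$ (that is, $s=\sqrt{[3]_q}$), where $[k]_q=\frac{q^k-q^{-k}}{q-q^{-1}}$. For $A\in K^\times$ let $S_Q^*=S_Q\{p^*\}$ be the Schur function of the partition $Q$ as a polynomial in the power sums $p_1,p_2,\dots$, evaluated at $p_k=p_k^*=\frac{A^k-A^{-k}}{q^k-q^{-k}}$. Explicitly $S_Q=\det(h_{Q_i-i+j})$ with $h_0=1$, $nh_n=\sum_{k=1}^n p_kh_{n-k}$, and $h_m=0$ for $m<0$. Put $$\hat R=\begin{pmatrix} q&0\\0&-\frac1q\end{pmatrix},\qquad U=\begin{pmatrix} C&S\\-S&C\end{pmatrix},\qquad C=\frac1{[2]_q},\qquad S=\frac{s}{[2]_q}.$$ For a finite sequence of integers $(a_1,b_1,a_2,b_2,\dots,a_n,b_n)$ let $\Sigma=\sum_i(a_i+b_i)$, let $h_{21}=\operatorname{tr}\prod_{i=1}^n\hat R^{a_i}\,U\hat R^{b_i}U^{T}$ (product in the order $i=1,\dots,n$),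 and $$F(A)=q^{\Sigma}S_3^*+\left(-\tfrac1q\right)^{\Sigma}S_{111}^*+h_{21}\,S_{21}^*.$$ Let $T_0,\dots,T_{N-1}$ be the standard basis of $[1]=K^N$, and let $R$ be the quantum $R$-matrix on $[1]\otimes[1]$, with eigenvalues $q$ on $[2]$ and $-1/q$ on $[11]$: $R(T_i\otimes T_i)=q\,T_i\otimes T_i$ and, for $i<j$, $R(T_j\otimes T_i)=T_i\otimes T_j$, $R(T_i\otimes T_j)=T_j\otimes T_i+(q-q^{-1})\,T_i\otimes T_j$. Let $D=\operatorname{diag}(q^{N-1},q^{N-3},\dots,q^{1-N})$. The (unnormalized) HOMFLY polynomial at $A=q^N$ of the 3-strand braid given by the sequence is the weighted trace $$H_{[1]}=\operatorname{Tr}_{[1]^{\otimes3}}\Big(D^{\otimes3}\,(R\otimes I)^{a_1}(I\otimes R)^{b_1}(R\otimes I)^{a_2}(I\otimes R)^{b_2}\cdots\Big).$$ For $A\in K^\times$, a HOMFLY polynomial $P$ on closures of braids with at most $M$ strands ($3\le M\le\infty$; $M=\infty$ gives all oriented links) is a $K$-valued function on the braid groups $B_1,\dots,B_M$ (all $B_n$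 if $M=\infty$) that is invariant under the Markov moves $\alpha\beta\mapsto\beta\alpha$ and $\beta\mapsto\beta\sigma_n^{\pm1}$ ($\beta\in B_n$, $n<M$), equals $1$ on the trivial braid in $B_1$, and satisfies the skein relation $A\,P(\beta\sigma_i)-A^{-1}P(\beta\sigma_i^{-1})=(q-q^{-1})P(\beta)$. **Statement.** 1. $U$ is orthogonal, $UU^T=I$, and it is the mixing matrix in the sector $[21]$. That is, for $N=2$ and $U_q(sl_2)$ with $\Delta(E)=I\otimes E+E\otimes q^{-2H}$, where $E\,T_1=T_0$, $E\,T_0=0$, $q^{-2H}T_0=q^{-1}T_0$, $q^{-2H}T_1=q\,T_1$, the space of highest weight vectors of the representations $[21]$ in $[1]^{\otimes3}$ (those killed by $E$ on which $q^{-2H}$ acts as $q^{-1}$) has two orthogonal bases $(v_1,v_2)$ and $(w_1,w_2)$, for the standard bilinear form, all four vectors having the same nonzero square norm, such that $R\otimes I$ acts on $v_1,v_2$, and $I\otimes R$ acts on $w_1,w_2$, by $q$ and $-1/q$ respectively, and $w_j=\sum_iU_{ij}v_i$. 2. For every $N\ge1$ and every sequence $(a_1,b_1,\dots,a_n,b_n)$,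 $H_{[1]}=F(q^N)$. 3. Let $A\in K^\times$. Then a HOMFLY polynomial on closures of braids with at most three strands exists; and for every $3\le M\le\infty$, every HOMFLY polynomial $P$ on closures of braids with at most $M$ strands, and every sequence $(a_1,b_1,\dots,a_n,b_n)$, $$A^{\Sigma}\,S_1^*\,P\big(\sigma_1^{a_1}\sigma_2^{b_1}\sigma_1^{a_2}\sigma_2^{b_2}\cdots\big)=F(A).$$ 4. For every row of the following table, $h_{21}$ is as listed and $F(A)=S_1^*\,(uA^2+v+wA^{-2})$ for all $A\in K^\times$. A row gives the name of the knot, the sequence $(a_1,b_1,\dots)$, then $h_{21}$, then $u,v,w$; here $[c_0,c_1,c_2,\dots]$ stands for $c_0+\sum_{k\ge1}c_k(q^{2k}+q^{-2k})$, and $[\,]$ for $0$. - $3_{1}$: $(-1,-1,-1,-1)$; $[-1]$; $[\,]$, $[-1]$, $[0,1]$ - $4_{1}$: $(1,-1,1,-1)$; $[1,-2,1]$; $[1]$, $[1,-1]$, $[1]$ - $5_{2}$: $(-1,1,-1,-3)$; $[-1,1,-1]$; $[-1]$, $[-1,1]$, $[-1,1]$ - $6_{2}$: $(1,-1,1,-3)$;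 $[-3,2,-2,1]$; $[-1,1]$, $[-2,1,-1]$, $[0,1]$ - $6_{3}$: $(2,-1,1,-2)$; $[3,-3,2,-1]$; $[1,-1]$, $[3,-1,1]$, $[1,-1]$ - $7_{3}$: $(1,-1,1,5)$; $[3,-2,1,-1]$; $[1,-1,1]$, $[2,-1,1]$, $[0,-1]$ - $7_{5}$: $(-2,1,-1,-4)$; $[3,-3,2,-1]$; $[1,-1]$, $[2,-2,1]$, $[2,-1,1]$ - $8_{2}$: $(1,-1,1,-5)$; $[3,-3,2,-2,1]$; $[1,-1,1]$, $[1,-2,1,-1]$, $[1,0,1]$ - $8_{5}$: $(-1,3,-1,3)$; $[3,-4,3,-2,1]$; $[2,0,1]$, $[1,-3,1,-1]$, $[2,-1,1]$ - $8_{7}$: $(-2,1,-1,4)$; $[-5,4,-3,2,-1]$; $[-1,1,-1]$, $[-2,3,-1,1]$, $[-2,1,-1]$ - $8_{9}$: $(3,-1,1,-3)$; $[5,-5,3,-2,1]$; $[2,-1,1]$, $[3,-3,1,-1]$, $[2,-1,1]$ - $8_{10}$: $(-2,2,-1,3)$; $[-5,5,-4,2,-1]$; $[-2,1,-1]$, $[-2,4,-1,1]$,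 $[-3,1,-1]$ - $8_{16}$: $(1,-1,1,-2,1,-2)$; $[-7,6,-5,3,-1]$; $[-3,2,-1]$, $[-4,4,-2,1]$, $[-2,2,-1]$ - $8_{17}$: $(2,-1,1,-1,1,-2)$; $[7,-7,5,-3,1]$; $[3,-2,1]$, $[5,-4,2,-1]$, $[3,-2,1]$ - $8_{18}$: $(1,-1,1,-1,1,-1,1,-1)$; $[9,-8,6,-4,1]$; $[3,-3,1]$, $[7,-4,3,-1]$, $[3,-3,1]$ - $8_{19}$: $(1,3,1,3)$; $[-1]$; $[1,1,0,1]$, $[-1,-1,-1]$, $[1]$ - $8_{19}$: $(1,1,1,1,1,1,1,1)$; $[-1]$; $[1,1,0,1]$, $[-1,-1,-1]$, $[1]$ - $8_{20}$: $(-1,-3,-1,3)$; $[1,-1,1,-1]$; $[0,-1]$, $[2,0,1]$, $[1,-1]$ - $8_{21}$: $(-2,2,-1,-3)$; $[-3,2,-2,1]$; $[-1,1]$, $[-3,1,-1]$, $[-1,2]$ - $10_{139}$: $(2,3,1,4)$; $[-1,1,-1]$; $[0,1,1,0,1]$, $[-2,0,-1,-1]$, $[-1,1]$ - $10_{139}$: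 $(1,-1,1,3,1,1,1,1,1,1)$; $[-1,1,-1]$; $[0,1,1,0,1]$, $[-2,0,-1,-1]$, $[-1,1]$ -/

import Mathlib

open scoped Kronecker Matrix

noncomputable section

namespace ThreeStrand

/-! ### Schur functions at the topological locus -/

/-- The `q`-number `[k]_q = (q^k - q^{-k}) / (q - q^{-1})`. -/
def qNum {K : Type*} [Field K] (q : K) (k : ℤ) : K :=
  (q ^ k - q ^ (-k)) / (q - q⁻¹)

/-- The complete homogeneous symmetric functions `h_n` written in the power sums ("times")
`p_1, p_2, …` through `n h_n = p_n h_0 + p_{n-1} h_1 + … + p_1 h_{n-1}`, `h_0 = 1`. -/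
def completeH {K : Type*} [Field K] (p : ℕ → K) : ℕ → K
  | 0 => 1
  | n + 1 => (∑ i : Fin (n + 1), p (n + 1 - i) * completeH p i) / ((n : K) + 1)

/-- The Schur function of the partition `Q` in the power sums `p`, by the Jacobi–Trudi
determinant `S_Q = det (h_{Q_i - i + j})`, where `h_m = 0` for `m < 0`. -/
def schur {K : Type*} [Field K] (p : ℕ → K) (Q : List ℕ) : K :=
  Matrix.det (Matrix.of fun i j : Fin Q.length =>
    if (i : ℕ) ≤ Q.get i + j then completeH p (Q.get i + j - i) else 0)

/-- The special point `p_k^* = (A^k - A^{-k}) / (q^k - q^{-k})`. -/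
def pStar {K : Type*} [Field K] (A q : K) (k : ℕ) : K :=
  (A ^ k - (A ^ k)⁻¹) / (q ^ k - (q ^ k)⁻¹)

/-- `S_Q^* = S_Q {p^*}`. -/
def schurStar {K : Type*} [Field K] (A q : K) (Q : List ℕ) : K :=
  schur (pStar A q) Q

/-! ### Braid words -/

/-- The exponent sum `a_1 + b_1 + a_2 + b_2 + …` of the word `(a_1, b_1), (a_2, b_2), …`. -/
def expSum (L : List (ℤ × ℤ)) : ℤ := (L.map fun p => p.1 + p.2).sum

/-! ### The weighted trace of quantum `R`-matrices -/

/-- The quantum `R`-matrix (composed with the flip) of the fundamental representation of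
`U_q(gl_N)` acting on `[1] ⊗ [1]`, with eigenvalues `q` on `[2]` and `-1/q` on `[11]`:
`T_i ⊗ T_i ↦ q T_i ⊗ T_i`, and for `i < j`
`T_j ⊗ T_i ↦ T_i ⊗ T_j`, `T_i ⊗ T_j ↦ T_j ⊗ T_i + (q - q⁻¹) T_i ⊗ T_j`. -/
def rMatrix {K : Type*} [Field K] (N : ℕ) (q : K) : Matrix (Fin N × Fin N) (Fin N × Fin N) K :=
  Matrix.of fun x y =>
    if x = y then (if x.1 = x.2 then q else if x.1 < x.2 then q - q⁻¹ else 0)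
    else if x = y.swap then 1 else 0

/-- `R ⊗ I` on the cube of the fundamental representation. -/
def rLeft {K : Type*} [Field K] (N : ℕ) (q : K) :
    Matrix ((Fin N × Fin N) × Fin N) ((Fin N × Fin N) × Fin N) K :=
  rMatrix N q ⊗ₖ (1 : Matrix (Fin N) (Fin N) K)

/-- `I ⊗ R` on the cube of the fundamental representation. -/
def rRight {K : Type*} [Field K] (N : ℕ) (q : K) :
    Matrix ((Fin N × Fin N) × Fin N) ((Fin N × Fin N) × Fin N) K :=
  ((1 : Matrix (Fin N) (Fin N) K) ⊗ₖ rMatrix N q).submatrix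
    (Equiv.prodAssoc (Fin N) (Fin N) (Fin N)) (Equiv.prodAssoc (Fin N) (Fin N) (Fin N))

/-- The weight matrix `q^ρ`, with diagonal entries `q^{N-1}, q^{N-3}, …, q^{1-N}`. -/
def weightMatrix {K : Type*} [Field K] (N : ℕ) (q : K) : Matrix (Fin N) (Fin N) K :=
  Matrix.diagonal fun i => q ^ ((N : ℤ) - 1 - 2 * (i : ℤ))

/-- The unnormalized fundamental HOMFLY polynomial at `A = q^N` of the 3-strand braid
`(a_1, b_1, a_2, b_2, …)`: the weighted trace of
`(R ⊗ I)^{a_1} (I ⊗ R)^{b_1} (R ⊗ I)^{a_2} (I ⊗ R)^{b_2} …` over `[1]^{⊗ 3}`. -/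
def homflyTrace {K : Type*} [Field K] (N : ℕ) (q : K) (L : List (ℤ × ℤ)) : K :=
  Matrix.trace (((weightMatrix N q ⊗ₖ weightMatrix N q) ⊗ₖ weightMatrix N q) *
    (L.map fun p => rLeft N q ^ p.1 * rRight N q ^ p.2).prod)

/-! ### The mixing matrix and the character expansion -/

/-- `diag (q, -1/q)`. -/
def rHat {K : Type*} [Field K] (q : K) : Matrix (Fin 2) (Fin 2) K :=
  !![q, 0; 0, -q⁻¹]

/-- The mixing matrix with `C = 1/[2]_q` and `S = s/[2]_q`, where `s` stands for `√[3]_q`. -/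
def mixing {K : Type*} [Field K] (q s : K) : Matrix (Fin 2) (Fin 2) K :=
  !![1 / qNum q 2, s / qNum q 2; -(s / qNum q 2), 1 / qNum q 2]

/-- The coefficient of `S_{21}^*`: the trace of
`R̂^{a_1} (U R̂^{b_1} Uᵀ) R̂^{a_2} (U R̂^{b_2} Uᵀ) …`. -/
def coeff21 {K : Type*} [Field K] (q s : K) (L : List (ℤ × ℤ)) : K :=
  Matrix.trace (L.map fun p =>
    rHat q ^ p.1 * (mixing q s * rHat q ^ p.2 * (mixing q s)ᵀ)).prod

/-- The character expansion
`q^Σ S_3^* + (-1/q)^Σ S_{111}^* + tr (…) S_{21}^*`. -/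
def characterExpansion {K : Type*} [Field K] (q s A : K) (L : List (ℤ × ℤ)) : K :=
  q ^ expSum L * schurStar A q [3] + (-q⁻¹) ^ expSum L * schurStar A q [1, 1, 1]
    + coeff21 q s L * schurStar A q [2, 1]

/-- The raising operator of `U_q(sl_2)` on the fundamental representation,
`T_1 ↦ T_0`, `T_0 ↦ 0`. -/
def raiseOne {K : Type*} [Field K] : Matrix (Fin 2) (Fin 2) K := !![0, 1; 0, 0]

/-- `q^{-2H}` on the fundamental representation of `U_q(sl_2)`. -/
def cartanOne {K : Type*} [Field K] (q : K) : Matrix (Fin 2) (Fin 2) K := !![q⁻¹, 0; 0, q]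

/-- `E` on `[1]^{⊗ 3}`, through `Δ(E) = I ⊗ E + E ⊗ q^{-2H}`. -/
def raiseCube {K : Type*} [Field K] (q : K) :
    Matrix ((Fin 2 × Fin 2) × Fin 2) ((Fin 2 × Fin 2) × Fin 2) K :=
  (1 : Matrix (Fin 2 × Fin 2) (Fin 2 × Fin 2) K) ⊗ₖ raiseOne +
    ((1 : Matrix (Fin 2) (Fin 2) K) ⊗ₖ raiseOne + raiseOne ⊗ₖ cartanOne q) ⊗ₖ cartanOne q

/-- `q^{-2H}` on `[1]^{⊗ 3}`. -/
def cartanCube {K : Type*} [Field K] (q : K) :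
    Matrix ((Fin 2 × Fin 2) × Fin 2) ((Fin 2 × Fin 2) × Fin 2) K :=
  (cartanOne q ⊗ₖ cartanOne q) ⊗ₖ cartanOne q

/-- The space of highest weight vectors of the representations `[21]` in `[1]^{⊗ 3}` for
`U_q(sl_2)`: the vectors killed by `E` on which `q^{-2H}` acts as `q^{-1}`. -/
def highestWeight21 {K : Type*} [Field K] (q : K) :
    Submodule K ((Fin 2 × Fin 2) × Fin 2 → K) :=
  LinearMap.ker (raiseCube q).mulVecLin ⊓
    LinearMap.ker (cartanCube q - q⁻¹ • (1 : Matrix _ _ K)).mulVecLin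

/-- `U` relates two bases of the highest weight vectors of `[21]` in `[1]^{⊗ 3}`, orthogonal and
with all vectors of one and the same nonzero square norm `ν`: the basis `b`, which diagonalizes
`R ⊗ I` (first fuse strands 1 and 2 into `[2]` or `[11]`), and the basis `c`, which diagonalizes
`I ⊗ R` (first fuse strands 2 and 3). -/
def IsMixingMatrix {K : Type*} [Field K] (q : K) (U : Matrix (Fin 2) (Fin 2) K) : Prop :=
  ∃ (b c : Fin 2 → ((Fin 2 × Fin 2) × Fin 2 → K)) (ν : K), ν ≠ 0 ∧
    Submodule.span K (Set.range b) = highestWeight21 q ∧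
    Submodule.span K (Set.range c) = highestWeight21 q ∧
    (∀ i j, b i ⬝ᵥ b j = if i = j then ν else 0) ∧
    (∀ i j, c i ⬝ᵥ c j = if i = j then ν else 0) ∧
    (∀ i, rLeft 2 q *ᵥ b i = rHat q i i • b i) ∧
    (∀ i, rRight 2 q *ᵥ c i = rHat q i i • c i) ∧
    ∀ j, c j = ∑ i, U i j • b i

/-! ### The HOMFLY polynomial of closed braids through the skein relation -/

/-- The relations of the braid group with generators `σ_0, …, σ_{n-1}`. -/
def braidRels (n : ℕ) : Set (FreeGroup (Fin n)) :=
  {r | ∃ i j : Fin n,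
    ((i : ℕ) + 1 = j ∧ r = FreeGroup.of i * FreeGroup.of j * FreeGroup.of i *
      (FreeGroup.of j * FreeGroup.of i * FreeGroup.of j)⁻¹) ∨
    ((i : ℕ) + 1 < j ∧ r = FreeGroup.of i * FreeGroup.of j *
      (FreeGroup.of j * FreeGroup.of i)⁻¹)}

/-- The braid group on `n + 1` strands, with the `n` Artin generators. -/
abbrev Braid (n : ℕ) : Type := PresentedGroup (braidRels n)

/-- The Artin generator `σ_i`. -/
def sigma {n : ℕ} (i : Fin n) : Braid n := PresentedGroup.of i

theorem braidRels_castSucc (n : ℕ) (r : FreeGroup (Fin n)) (hr : r ∈ braidRels n) :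
    FreeGroup.lift (fun i : Fin n => sigma i.castSucc) r = 1 := by
  have key : ∀ r ∈ braidRels (n + 1), PresentedGroup.mk (braidRels (n + 1)) r = 1 :=
    fun r hr => PresentedGroup.one_of_mem hr
  obtain ⟨i, j, ⟨h, rfl⟩ | ⟨h, rfl⟩⟩ := hr
  · simpa [sigma, PresentedGroup.of] using
      key _ ⟨i.castSucc, j.castSucc, Or.inl ⟨by simpa using h, rfl⟩⟩
  · simpa [sigma, PresentedGroup.of] using
      key _ ⟨i.castSucc, j.castSucc, Or.inr ⟨by simpa using h, rfl⟩⟩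

/-- Adding one trivial strand on the right of a braid. -/
def addStrand (n : ℕ) : Braid n →* Braid (n + 1) :=
  PresentedGroup.toGroup (braidRels_castSucc n)

/-- The HOMFLY polynomial, as a function on the closures of braids with at most `M` strands
(`M = ⊤` gives all oriented links): it takes the value 1 on the unknot, it does not
change under the two Markov moves, i.e. it depends on the closure only, and it satisfies the
skein relation `A P(L_+) - A⁻¹ P(L_-) = (q - q⁻¹) P(L_0)`. -/
structure IsHomfly {K : Type*} [Field K] (A q : K) (M : ℕ∞) (P : ∀ n : ℕ, Braid n → K) :
    Prop where
  unknot : P 0 1 = 1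
  conj : ∀ n : ℕ, ((n + 1 : ℕ) : ℕ∞) ≤ M → ∀ α β : Braid n, P n (α * β) = P n (β * α)
  stab_pos : ∀ n : ℕ, ((n + 2 : ℕ) : ℕ∞) ≤ M → ∀ β : Braid n,
    P (n + 1) (addStrand n β * sigma (Fin.last n)) = P n β
  stab_neg : ∀ n : ℕ, ((n + 2 : ℕ) : ℕ∞) ≤ M → ∀ β : Braid n,
    P (n + 1) (addStrand n β * (sigma (Fin.last n))⁻¹) = P n β
  skein : ∀ n : ℕ, ((n + 1 : ℕ) : ℕ∞) ≤ M → ∀ (i : Fin n) (β : Braid n),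
    A * P n (β * sigma i) - A⁻¹ * P n (β * (sigma i)⁻¹) = (q - q⁻¹) * P n β

/-- The 3-strand braid `σ_1^{a_1} σ_2^{b_1} σ_1^{a_2} σ_2^{b_2} …`. -/
def braidOf (L : List (ℤ × ℤ)) : Braid 2 :=
  (L.map fun p => sigma (0 : Fin 2) ^ p.1 * sigma (1 : Fin 2) ^ p.2).prod

/-! ### The table of 3-strand knots -/

/-- The palindromic Laurent polynomial
`c_0 + c_1 (q^2 + q^{-2}) + c_2 (q^4 + q^{-4}) + …` with the integer coefficients
`[c_0, c_1, c_2, …]`. -/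
def palin {K : Type*} [Field K] (q : K) : List ℤ → K
  | [] => 0
  | c :: l => (c : K) + ∑ i : Fin l.length,
      ((l.get i : ℤ) : K) * (q ^ (2 * ((i : ℕ) + 1)) + (q ^ (2 * ((i : ℕ) + 1)))⁻¹)

/-- A row of the table: a braid word, the coefficient of `S_{21}^*`, and the coefficients of
`A^2`, `A^0`, `A^{-2}` in the ratio `H / S_1^*`; all four are palindromic Laurent polynomials in
`q`, recorded by their coefficients as in `palin`. -/
structure Row where
  word : List (ℤ × ℤ)
  h21 : List ℤ
  aPos : List ℤ
  aZero : List ℤ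
  aNeg : List ℤ

/-- The table of 3-strand knots; the comments give the names of the knots. -/
def knotTable : List Row :=
  [
    -- 3_1
    ⟨[(-1, -1), (-1, -1)],
      [-1], [], [-1], [0, 1]⟩,
    -- 4_1
    ⟨[(1, -1), (1, -1)],
      [1, -2, 1], [1], [1, -1], [1]⟩,
    -- 5_2
    ⟨[(-1, 1), (-1, -3)],
      [-1, 1, -1], [-1], [-1, 1], [-1, 1]⟩,
    -- 6_2
    ⟨[(1, -1), (1, -3)],
      [-3, 2, -2, 1], [-1, 1], [-2, 1, -1], [0, 1]⟩,
    -- 6_3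
    ⟨[(2, -1), (1, -2)],
      [3, -3, 2, -1], [1, -1], [3, -1, 1], [1, -1]⟩,
    -- 7_3
    ⟨[(1, -1), (1, 5)],
      [3, -2, 1, -1], [1, -1, 1], [2, -1, 1], [0, -1]⟩,
    -- 7_5
    ⟨[(-2, 1), (-1, -4)],
      [3, -3, 2, -1], [1, -1], [2, -2, 1], [2, -1, 1]⟩,
    -- 8_2
    ⟨[(1, -1), (1, -5)],
      [3, -3, 2, -2, 1], [1, -1, 1], [1, -2, 1, -1], [1, 0, 1]⟩,
    -- 8_5
    ⟨[(-1, 3), (-1, 3)],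
      [3, -4, 3, -2, 1], [2, 0, 1], [1, -3, 1, -1], [2, -1, 1]⟩,
    -- 8_7
    ⟨[(-2, 1), (-1, 4)],
      [-5, 4, -3, 2, -1], [-1, 1, -1], [-2, 3, -1, 1], [-2, 1, -1]⟩,
    -- 8_9
    ⟨[(3, -1), (1, -3)],
      [5, -5, 3, -2, 1], [2, -1, 1], [3, -3, 1, -1], [2, -1, 1]⟩,
    -- 8_10
    ⟨[(-2, 2), (-1, 3)],
      [-5, 5, -4, 2, -1], [-2, 1, -1], [-2, 4, -1, 1], [-3, 1, -1]⟩,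
    -- 8_16
    ⟨[(1, -1), (1, -2), (1, -2)],
      [-7, 6, -5, 3, -1], [-3, 2, -1], [-4, 4, -2, 1], [-2, 2, -1]⟩,
    -- 8_17
    ⟨[(2, -1), (1, -1), (1, -2)],
      [7, -7, 5, -3, 1], [3, -2, 1], [5, -4, 2, -1], [3, -2, 1]⟩,
    -- 8_18
    ⟨[(1, -1), (1, -1), (1, -1), (1, -1)],
      [9, -8, 6, -4, 1], [3, -3, 1], [7, -4, 3, -1], [3, -3, 1]⟩,
    -- 8_19
    ⟨[(1, 3), (1, 3)],
      [-1], [1, 1, 0, 1], [-1, -1, -1], [1]⟩,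
    -- 8_19
    ⟨[(1, 1), (1, 1), (1, 1), (1, 1)],
      [-1], [1, 1, 0, 1], [-1, -1, -1], [1]⟩,
    -- 8_20
    ⟨[(-1, -3), (-1, 3)],
      [1, -1, 1, -1], [0, -1], [2, 0, 1], [1, -1]⟩,
    -- 8_21
    ⟨[(-2, 2), (-1, -3)],
      [-3, 2, -2, 1], [-1, 1], [-3, 1, -1], [-1, 2]⟩,
    -- 10_139
    ⟨[(2, 3), (1, 4)],
      [-1, 1, -1], [0, 1, 1, 0, 1], [-2, 0, -1, -1], [-1, 1]⟩,
    -- 10_139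
    ⟨[(1, -1), (1, 3), (1, 1), (1, 1), (1, 1)],
      [-1, 1, -1], [0, 1, 1, 0, 1], [-2, 0, -1, -1], [-1, 1]⟩ ]

end ThreeStrand

end

/-! Both sides of each three-strand identity are traces on the Hecke algebra. Such a trace is fixed
by its values at `1`, `sigma 1` and `sigma 0 * sigma 1` (`IsHeckeTrace.ext`): the quadratic relation
reduces every braid to the six positive permutation braids, and conjugation together with the
quadratic relation leaves these three.

Four functions qualify. The character expansion does, since `σ ↦ q`, `σ ↦ -1/q` and the pair `R̂, U
R̂ Uᵀ` satisfy the braid and Hecke relations. So do the weighted trace, because the weight commutes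
with the `R`-matrices; `A^Σ P` for a HOMFLY polynomial `P`; and the trace of the reduced Burau
representation.

Put `δ = (A - A⁻¹)/(q - q⁻¹) = S_1^*`. The expansion divided by `S_1^*` takes the values `δ²`, `Aδ`,
`A²` (`reducedExpansion_values`). The Markov moves and the skein relation force the same values on
`A^Σ P`, and closing the strands one at a time gives `δ` times these values for the weighted trace.
For existence, the expansion itself, with its two-strand analogue, serves as the definition; as the
two-strand braid group is cyclic, stabilization is checked on powers of one generator only.

For the table, `h_21` is computed in the Burau representation, where `s` is absent, and each row
becomes a set of Laurent polynomial identities in `q`. That `U` is the mixing matrix is seen on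
explicit fusion bases. -/

namespace ThreeStrand

/-! ### Traces on the three-strand Hecke algebra -/

/-- Functions on the three-strand braid group that factor through a trace on the Hecke algebra. -/
structure IsHeckeTrace {K : Type*} [Field K] (q : K) (f : Braid 2 → K) : Prop where
  comm : ∀ α β, f (α * β) = f (β * α)
  skein : ∀ i β, f (β * sigma i) - f (β * (sigma i)⁻¹) = (q - q⁻¹) * f β

theorem closure_range_sigma (n : ℕ) :
    Subgroup.closure (Set.range (sigma : Fin n → Braid n)) = ⊤ :=
  PresentedGroup.closure_range_of _

theorem sigma_braid :
    sigma (0 : Fin 2) * sigma 1 * sigma 0 = sigma (1 : Fin 2) * sigma 0 * sigma 1 := by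
  have h : PresentedGroup.mk (braidRels 2) _ = 1 :=
    PresentedGroup.one_of_mem ⟨0, 1, Or.inl ⟨rfl, rfl⟩⟩
  rw [map_mul, map_inv, mul_inv_eq_one] at h
  simpa [sigma, PresentedGroup.of] using h

namespace IsHeckeTrace

variable {K : Type*} [Field K] {q : K} {f g : Braid 2 → K}

theorem sub (hf : IsHeckeTrace q f) (hg : IsHeckeTrace q g) : IsHeckeTrace q (f - g) where
  comm α β := by simp [hf.comm α β, hg.comm α β]
  skein i β := by
    simp only [Pi.sub_apply]
    linear_combination hf.skein i β - hg.skein i β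

theorem mul_sigma_sigma (hf : IsHeckeTrace q f) (i : Fin 2) (β : Braid 2) :
    f (β * sigma i * sigma i) = f β + (q - q⁻¹) * f (β * sigma i) := by
  have h := hf.skein i (β * sigma i)
  rw [mul_inv_cancel_right] at h
  linear_combination h

/-- In a trace, every braid can be replaced by a combination of the six positive permutation
braids. -/
theorem exists_reduction (hf : IsHeckeTrace q f) (β : Braid 2) :
    ∃ c : Fin 6 → K, ∀ α, f (α * β) = c 0 * f α + c 1 * f (α * sigma 0) + c 2 * f (α * sigma 1)
      + c 3 * f (α * sigma 0 * sigma 1) + c 4 * f (α * sigma 1 * sigma 0)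
      + c 5 * f (α * sigma 0 * sigma 1 * sigma 0) := by
  have braid : ∀ α : Braid 2, α * sigma 1 * sigma 0 * sigma 1 = α * sigma 0 * sigma 1 * sigma 0 := by
    intro α
    simpa only [mul_assoc] using congrArg (α * ·) sigma_braid.symm
  have pos : ∀ (i : Fin 2) (β : Braid 2), (∃ c : Fin 6 → K, ∀ α, f (α * β) =
      c 0 * f α + c 1 * f (α * sigma 0) + c 2 * f (α * sigma 1)
      + c 3 * f (α * sigma 0 * sigma 1) + c 4 * f (α * sigma 1 * sigma 0)
      + c 5 * f (α * sigma 0 * sigma 1 * sigma 0)) → ∃ c : Fin 6 → K, ∀ α, f (α * (β * sigma i)) =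
      c 0 * f α + c 1 * f (α * sigma 0) + c 2 * f (α * sigma 1)
      + c 3 * f (α * sigma 0 * sigma 1) + c 4 * f (α * sigma 1 * sigma 0)
      + c 5 * f (α * sigma 0 * sigma 1 * sigma 0) := by
    rintro i β ⟨c, hc⟩
    -- The last generator is rotated to the front, so that the hypothesis applies to `sigma i * α`,
    -- and then rotated back. This turns right multiplication of `β` into right multiplication of
    -- the six basis words.
    have rot : ∀ α, f (α * (β * sigma i)) = c 0 * f (α * sigma i) + c 1 * f (α * sigma 0 * sigma i)
        + c 2 * f (α * sigma 1 * sigma i) + c 3 * f (α * sigma 0 * sigma 1 * sigma i)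
        + c 4 * f (α * sigma 1 * sigma 0 * sigma i)
        + c 5 * f (α * sigma 0 * sigma 1 * sigma 0 * sigma i) := by
      intro α
      rw [← mul_assoc, hf.comm, ← mul_assoc, hc]
      simp only [mul_assoc, hf.comm (sigma i)]
    fin_cases i
    -- Right multiplication by `sigma 0` pairs the words as `w` and `w * sigma 0`; on the longer
    -- word of each pair the quadratic relation applies.
    · refine ⟨![c 1, c 0 + (q - q⁻¹) * c 1, c 4, c 5, c 2 + (q - q⁻¹) * c 4,
        c 3 + (q - q⁻¹) * c 5], fun α => ?_⟩
      have h := rot α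
      simp only [Fin.zero_eta] at h ⊢
      rw [h, hf.mul_sigma_sigma 0 α, hf.mul_sigma_sigma 0 (α * sigma 1),
        hf.mul_sigma_sigma 0 (α * sigma 0 * sigma 1)]
      simp
      ring
    -- The same with `sigma 1`, where the longest word is first rewritten to end in `sigma 1` by the
    -- braid relation.
    · refine ⟨![c 2, c 3, c 0 + (q - q⁻¹) * c 2, c 1 + (q - q⁻¹) * c 3, c 5,
        c 4 + (q - q⁻¹) * c 5], fun α => ?_⟩
      have h := rot α
      simp only [Fin.mk_one] at h ⊢
      rw [h, hf.mul_sigma_sigma 1 α, hf.mul_sigma_sigma 1 (α * sigma 0), braid,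
        ← braid α, hf.mul_sigma_sigma 1 (α * sigma 1 * sigma 0), braid]
      simp
      ring
  have hβ : β ∈ Subgroup.closure (Set.range (sigma : Fin 2 → Braid 2)) := by
    rw [closure_range_sigma]; trivial
  induction hβ using Subgroup.closure_induction_right with
  | one => exact ⟨![1, 0, 0, 0, 0, 0], fun α => by simp⟩
  | mul_right x hx y hy ih =>
    obtain ⟨i, rfl⟩ := hy
    exact pos i x ih
  | mul_inv_cancel x hx y hy ih =>
    obtain ⟨i, rfl⟩ := hy
    obtain ⟨c, hc⟩ := ih
    obtain ⟨d, hd⟩ := pos i x ⟨c, hc⟩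
    -- Under the trace, `σ⁻¹ = σ - (q - q⁻¹)`.
    refine ⟨d - (q - q⁻¹) • c, fun α => ?_⟩
    have h := hf.skein i (α * x)
    rw [mul_assoc α x, mul_assoc α x, hd, hc] at h
    simp only [Pi.sub_apply, Pi.smul_apply, smul_eq_mul]
    linear_combination -h

/-- A Hecke trace on three strands is determined by three of its values. -/
theorem ext (hf : IsHeckeTrace q f) (hg : IsHeckeTrace q g) (h1 : f 1 = g 1)
    (hs : f (sigma 1) = g (sigma 1)) (hss : f (sigma 0 * sigma 1) = g (sigma 0 * sigma 1)) :
    f = g := by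
  have hd := hf.sub hg
  rw [← sub_eq_zero]
  generalize hfg : f - g = d at hd
  have d1 : d 1 = 0 := by simp [← hfg, h1]
  have ds : d (sigma 1) = 0 := by simp [← hfg, hs]
  have dss : d (sigma 0 * sigma 1) = 0 := by simp [← hfg, hss]
  -- The two generators are conjugate, through `sigma 0 * sigma 1`.
  have d0 : d (sigma 0) = 0 := by
    have h : (sigma 0 * sigma 1) * (sigma (0 : Fin 2) * (sigma 0 * sigma 1)⁻¹) = sigma 1 := by
      rw [← mul_assoc, sigma_braid]
      group
    rw [← ds, ← h, hd.comm]
    group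
  have dss' : d (sigma 1 * sigma 0) = 0 := by rw [hd.comm, dss]
  -- Up to cyclic rotation the longest word is `sigma 1 * sigma 0 ^ 2`, which the quadratic relation
  -- reduces.
  have dsss : d (sigma 0 * sigma 1 * sigma 0) = 0 := by
    have h := hd.mul_sigma_sigma 0 (sigma 1)
    rw [ds, dss', mul_assoc] at h
    rw [mul_assoc, hd.comm, mul_assoc]
    simpa using h
  funext β
  obtain ⟨c, hc⟩ := hd.exists_reduction β
  have h := hc 1
  simpa [d1, ds, dss, d0, dss', dsss] using h

end IsHeckeTrace

/-! ### Representations and characters of the braid groups -/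

/-- The representation of the three-strand braid group given by two invertible elements that
satisfy the braid relation. -/
def braidRep {G : Type*} [Group G] (x y : G) (h : x * y * x = y * x * y) : Braid 2 →* G :=
  PresentedGroup.toGroup (f := ![x, y]) (by
    rintro r ⟨i, j, ⟨hij, rfl⟩ | ⟨hij, rfl⟩⟩
    · obtain ⟨rfl, rfl⟩ : i = 0 ∧ j = 1 := by omega
      simp [h]
    · omega)

@[simp]
theorem braidRep_zero {G : Type*} [Group G] (x y : G) (h : x * y * x = y * x * y) :
    braidRep x y h (sigma 0) = x :=
  PresentedGroup.toGroup.of _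

@[simp]
theorem braidRep_one {G : Type*} [Group G] (x y : G) (h : x * y * x = y * x * y) :
    braidRep x y h (sigma 1) = y :=
  PresentedGroup.toGroup.of _

theorem map_braidOf {G : Type*} [Group G] (φ : Braid 2 →* G) (L : List (ℤ × ℤ)) :
    φ (braidOf L) = (L.map fun p => φ (sigma 0) ^ p.1 * φ (sigma 1) ^ p.2).prod := by
  simp [braidOf, map_list_prod, Function.comp_def]

/-- A linear functional that is a trace on the image of a Hecke representation of the braid
group gives a Hecke trace. -/
theorem IsHeckeTrace.of_rep {K 𝒜 : Type*} [Field K] [Ring 𝒜] [Algebra K 𝒜] {q : K}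
    (ρ : Braid 2 →* 𝒜ˣ) (t : 𝒜 →ₗ[K] K)
    (comm : ∀ α β, t (ρ α * ρ β : 𝒜) = t (ρ β * ρ α : 𝒜))
    (hecke : ∀ i, (ρ (sigma i) : 𝒜) - ((ρ (sigma i))⁻¹ : 𝒜ˣ) = (q - q⁻¹) • (1 : 𝒜)) :
    IsHeckeTrace q fun β => t (ρ β : 𝒜) where
  comm α β := by simpa using comm α β
  skein i β := by
    rw [← map_sub, map_mul, map_mul, map_inv, Units.val_mul, Units.val_mul, ← mul_sub, hecke]
    simp

theorem IsHeckeTrace.add {K : Type*} [Field K] {q : K} {f g : Braid 2 → K}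
    (hf : IsHeckeTrace q f) (hg : IsHeckeTrace q g) : IsHeckeTrace q (f + g) where
  comm α β := by simp [hf.comm α β, hg.comm α β]
  skein i β := by
    simp only [Pi.add_apply]
    linear_combination hf.skein i β + hg.skein i β

theorem IsHeckeTrace.smul {K : Type*} [Field K] {q : K} {f : Braid 2 → K}
    (hf : IsHeckeTrace q f) (c : K) : IsHeckeTrace q (c • f) where
  comm α β := by simp [hf.comm α β]
  skein i β := by
    simp only [Pi.smul_apply, smul_eq_mul]
    linear_combination c * hf.skein i β

/-- The character of the braid group that sends every generator to `x`. -/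
def braidChar {G : Type*} [CommGroup G] (x : G) (n : ℕ) : Braid n →* G :=
  PresentedGroup.toGroup (f := fun _ : Fin n => x) (by
    rintro r ⟨i, j, ⟨hij, rfl⟩ | ⟨hij, rfl⟩⟩ <;> simp)

@[simp]
theorem braidChar_sigma {G : Type*} [CommGroup G] (x : G) {n : ℕ} (i : Fin n) :
    braidChar x n (sigma i) = x :=
  PresentedGroup.toGroup.of _

@[simp]
theorem addStrand_sigma {n : ℕ} (i : Fin n) : addStrand n (sigma i) = sigma i.castSucc :=
  PresentedGroup.toGroup.of _

theorem braidChar_braidOf {G : Type*} [CommGroup G] (x : G) (L : List (ℤ × ℤ)) :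
    braidChar x 2 (braidOf L) = x ^ expSum L := by
  rw [map_braidOf]
  induction L with
  | nil => simp [expSum]
  | cons p L ih =>
    simp only [braidChar_sigma] at ih
    simp [expSum, ih, zpow_add]

/-- The condition on `x` is the quadratic Hecke relation for a scalar; its roots `q` and `-1/q` give
the sectors `[3]` and `[111]`. -/
theorem IsHeckeTrace.braidChar {K : Type*} [Field K] {q : K} (x : Kˣ)
    (hx : (x : K) - (x : K)⁻¹ = q - q⁻¹) :
    IsHeckeTrace q fun β => (braidChar x 2 β : K) where
  comm α β := by simp [mul_comm]
  skein i β := by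
    simp only [map_mul, map_inv, braidChar_sigma, Units.val_mul, Units.val_inv_eq_inv_val]
    linear_combination (ThreeStrand.braidChar x 2 β : K) * hx

/-- `Braid 1` has two strands and one generator. Stabilization from two to three strands thus
concerns only the words `sigma 0 ^ k * (sigma 1)^{±1}`. -/
theorem braid_one_eq_zpow (β : Braid 1) : ∃ k : ℤ, β = sigma 0 ^ k := by
  have hβ : β ∈ Subgroup.closure (Set.range (sigma : Fin 1 → Braid 1)) := by
    rw [closure_range_sigma]; trivial
  rw [Set.range_unique, Subgroup.mem_closure_singleton] at hβ
  obtain ⟨k, hk⟩ := hβ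
  exact ⟨k, hk.symm⟩

theorem braid_zero_eq_one (β : Braid 0) : β = 1 := by
  have hβ : β ∈ Subgroup.closure (Set.range (sigma : Fin 0 → Braid 0)) := by
    rw [closure_range_sigma]; trivial
  simpa [Set.range_eq_empty] using hβ

/-! ### Values forced by the Markov moves and the skein relation -/

/-- On three strands, a HOMFLY polynomial is a Hecke trace after normalization of the framing. -/
theorem IsHomfly.isHeckeTrace {K : Type*} [Field K] {q : K} {A : Kˣ} {M : ℕ∞}
    {P : ∀ n, Braid n → K} (hP : IsHomfly (A : K) q M P) (hM : 3 ≤ M) :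
    IsHeckeTrace q fun β => (ThreeStrand.braidChar A 2 β : K) * P 2 β where
  comm α β := by
    have := hP.conj 2 hM α β
    simp [this, mul_comm]
  skein i β := by
    have := hP.skein 2 hM i β
    simp only [map_mul, map_inv, braidChar_sigma, Units.val_mul, Units.val_inv_eq_inv_val]
    linear_combination (ThreeStrand.braidChar A 2 β : K) * this

section HomflyValues

variable {K : Type*} [Field K] {q A : K} {M : ℕ∞} {P : ∀ n, Braid n → K}

/-- In the skein relation at the trivial two-strand braid, both crossings destabilize to the unknot.
-/
theorem IsHomfly.unlink_two (hP : IsHomfly A q M P) (hM : 3 ≤ M) (hq : q - q⁻¹ ≠ 0) :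
    P 1 1 = (A - A⁻¹) / (q - q⁻¹) := by
  have h2 : ((0 + 2 : ℕ) : ℕ∞) ≤ M := le_trans (by norm_num) hM
  have h := hP.skein 1 h2 0 1
  have hp := hP.stab_pos 0 h2 1
  have hn := hP.stab_neg 0 h2 1
  rw [map_one] at hp hn
  have e : (Fin.last 0 : Fin 1) = 0 := rfl
  simp only [e] at hp hn
  rw [hp, hn, hP.unknot] at h
  rw [eq_div_iff hq]
  linear_combination -h

theorem IsHomfly.unknot_three (hP : IsHomfly A q M P) (hM : 3 ≤ M) :
    P 2 (sigma 0 * sigma 1) = 1 := by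
  have h2 : ((0 + 2 : ℕ) : ℕ∞) ≤ M := le_trans (by norm_num) hM
  have hp := hP.stab_pos 0 h2 1
  have hp' := hP.stab_pos 1 hM (sigma 0)
  have e : (Fin.last 0 : Fin 1) = 0 := rfl
  have e' : (Fin.last 1 : Fin 2) = 1 := rfl
  rw [addStrand_sigma, Fin.castSucc_zero] at hp'
  rw [map_one] at hp
  simp only [one_mul, e, e'] at hp hp'
  exact hp'.trans (hp.trans hP.unknot)

theorem IsHomfly.unlink_two_three (hP : IsHomfly A q M P) (hM : 3 ≤ M) (hq : q - q⁻¹ ≠ 0) :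
    P 2 (sigma 1) = (A - A⁻¹) / (q - q⁻¹) := by
  have hp := hP.stab_pos 1 hM 1
  have e' : (Fin.last 1 : Fin 2) = 1 := rfl
  rw [map_one, one_mul, e', hP.unlink_two hM hq] at hp
  exact hp

/-- The skein relation at the trivial three-strand braid: the negative crossing destabilizes to the
two-component unlink, as the positive one does, which produces a second factor. -/
theorem IsHomfly.unlink_three (hP : IsHomfly A q M P) (hM : 3 ≤ M) (hq : q - q⁻¹ ≠ 0) :
    P 2 1 = ((A - A⁻¹) / (q - q⁻¹)) ^ 2 := by
  have hn := hP.stab_neg 1 hM 1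
  have h := hP.skein 2 hM 1 1
  have e' : (Fin.last 1 : Fin 2) = 1 := rfl
  rw [map_one, one_mul, e', hP.unlink_two hM hq] at hn
  rw [one_mul, one_mul, hn, hP.unlink_two_three hM hq] at h
  rw [sq, div_mul_eq_mul_div, eq_div_iff hq]
  linear_combination -h

end HomflyValues

/-! ### Quantum numbers and Schur functions in closed form -/

section Generic

variable {K : Type*} [Field K] {q s A : K}

theorem sq_add_one_ne_zero (hq4 : q ^ 4 ≠ 1) : q ^ 2 + 1 ≠ 0 := fun h =>
  hq4 (by linear_combination (q ^ 2 - 1) * h)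

/-- This is `(q^6 - 1)/(q^2 - 1)`, in the nested form that the factorizations of `q^3 - q^{-3}`
below use. -/
theorem quartic_ne_zero (hq6 : q ^ 6 ≠ 1) : q ^ 2 * (q ^ 2 + 1) + 1 ≠ 0 := fun h =>
  hq6 (by linear_combination (q ^ 2 - 1) * h)

theorem sub_inv_ne_zero (hq : q ≠ 0) (hq2 : q ^ 2 ≠ 1) : q - q⁻¹ ≠ 0 := fun h =>
  hq2 (by field_simp at h; linear_combination h)

theorem qNum_two (hq : q ≠ 0) (hq2 : q ^ 2 ≠ 1) : qNum q 2 = (q ^ 2 + 1) / q := by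
  have h := sub_inv_ne_zero hq hq2
  rw [qNum, div_eq_div_iff h hq, zpow_neg]
  norm_cast
  field_simp
  ring

theorem qNum_three (hq : q ≠ 0) (hq2 : q ^ 2 ≠ 1) :
    qNum q 3 = (q ^ 4 + q ^ 2 + 1) / q ^ 2 := by
  have h := sub_inv_ne_zero hq hq2
  rw [qNum, div_eq_div_iff h (pow_ne_zero 2 hq), zpow_neg]
  norm_cast
  field_simp
  ring

theorem mixing_eq (hq : q ≠ 0) (hq2 : q ^ 2 ≠ 1) :
    mixing q s = !![q / (q ^ 2 + 1), s * q / (q ^ 2 + 1);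
      -(s * q / (q ^ 2 + 1)), q / (q ^ 2 + 1)] := by
  rw [mixing, qNum_two hq hq2, one_div_div, div_div_eq_mul_div]

theorem schurStar_one : schurStar A q [1] = (A - A⁻¹) / (q - q⁻¹) := by
  simp [schurStar, schur, completeH, pStar]

variable [CharZero K]

/-- Principal specialization: `h_n` becomes the product of `(Aq^i - (Aq^i)⁻¹)/(q^{i+1} - q^{-i-1})`
over `0 ≤ i < n`. Only `n ≤ 3` is needed, and the recursion is evaluated directly. -/
theorem completeH_pStar_two (hq : q ≠ 0) (hq2 : q ^ 2 ≠ 1) (hq4 : q ^ 4 ≠ 1) (hA : A ≠ 0) :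
    completeH (pStar A q) 2 = (A - A⁻¹) / (q - q⁻¹) *
      ((A * q - (A * q)⁻¹) / (q ^ 2 - (q ^ 2)⁻¹)) := by
  have h1 : q ^ 2 - 1 ≠ 0 := sub_ne_zero.2 hq2
  have h2 := sq_add_one_ne_zero hq4
  have e1 : q - q⁻¹ = (q ^ 2 - 1) / q := by field_simp
  have e2 : q ^ 2 - (q ^ 2)⁻¹ = (q ^ 2 - 1) * (q ^ 2 + 1) / q ^ 2 := by field_simp; ring
  rw [completeH, Fin.sum_univ_two]
  simp [completeH, pStar, e1, e2]
  field_simp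
  ring

theorem completeH_pStar_three (hq : q ≠ 0) (hq2 : q ^ 2 ≠ 1) (hq4 : q ^ 4 ≠ 1) (hq6 : q ^ 6 ≠ 1)
    (hA : A ≠ 0) :
    completeH (pStar A q) 3 = (A - A⁻¹) / (q - q⁻¹) *
      ((A * q - (A * q)⁻¹) * (A * q ^ 2 - (A * q ^ 2)⁻¹) /
        ((q ^ 2 - (q ^ 2)⁻¹) * (q ^ 3 - (q ^ 3)⁻¹))) := by
  have h1 : q ^ 2 - 1 ≠ 0 := sub_ne_zero.2 hq2
  have h2 := sq_add_one_ne_zero hq4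
  have h3 := quartic_ne_zero hq6
  have e1 : q - q⁻¹ = (q ^ 2 - 1) / q := by field_simp
  have e2 : q ^ 2 - (q ^ 2)⁻¹ = (q ^ 2 - 1) * (q ^ 2 + 1) / q ^ 2 := by field_simp; ring
  have e3 : q ^ 3 - (q ^ 3)⁻¹ = (q ^ 2 - 1) * (q ^ 2 * (q ^ 2 + 1) + 1) / q ^ 3 := by field_simp; ring
  rw [completeH, Fin.sum_univ_three]
  simp only [Fin.val_zero, Fin.val_one, Fin.val_two]
  rw [completeH_pStar_two hq hq2 hq4 hA]
  simp [completeH, pStar, e1, e2, e3]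
  field_simp
  ring

/-- This and the next two are cases of the hook-content formula: a cell of content `c` and hook
length `h` contributes `(Aq^c - (Aq^c)⁻¹)/(q^h - q^{-h})`. The content-zero numerator and one hook
of length 1 form the factor `S_1^*`. -/
theorem schurStar_three (hq : q ≠ 0) (hq2 : q ^ 2 ≠ 1) (hq4 : q ^ 4 ≠ 1) (hq6 : q ^ 6 ≠ 1)
    (hA : A ≠ 0) :
    schurStar A q [3] = schurStar A q [1] *
      ((A * q - (A * q)⁻¹) * (A * q ^ 2 - (A * q ^ 2)⁻¹) /
        ((q ^ 2 - (q ^ 2)⁻¹) * (q ^ 3 - (q ^ 3)⁻¹))) := by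
  rw [schurStar_one, ← completeH_pStar_three hq hq2 hq4 hq6 hA]
  simp [schurStar, schur]

theorem schurStar_two_one (hq : q ≠ 0) (hq2 : q ^ 2 ≠ 1) (hq4 : q ^ 4 ≠ 1) (hq6 : q ^ 6 ≠ 1)
    (hA : A ≠ 0) :
    schurStar A q [2, 1] = schurStar A q [1] *
      ((A * q - (A * q)⁻¹) * (A * q⁻¹ - (A * q⁻¹)⁻¹) /
        ((q - q⁻¹) * (q ^ 3 - (q ^ 3)⁻¹))) := by
  have h1 : q ^ 2 - 1 ≠ 0 := sub_ne_zero.2 hq2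
  have h2 := sq_add_one_ne_zero hq4
  have h3 := quartic_ne_zero hq6
  have e1 : q - q⁻¹ = (q ^ 2 - 1) / q := by field_simp
  have e2 : q ^ 2 - (q ^ 2)⁻¹ = (q ^ 2 - 1) * (q ^ 2 + 1) / q ^ 2 := by field_simp; ring
  have e3 : q ^ 3 - (q ^ 3)⁻¹ = (q ^ 2 - 1) * (q ^ 2 * (q ^ 2 + 1) + 1) / q ^ 3 := by field_simp; ring
  have h : schurStar A q [2, 1] = completeH (pStar A q) 2 * completeH (pStar A q) 1 -
      completeH (pStar A q) 3 := by
    simp [schurStar, schur, Matrix.det_fin_two, completeH]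
  rw [h, completeH_pStar_three hq hq2 hq4 hq6 hA, completeH_pStar_two hq hq2 hq4 hA, schurStar_one]
  simp only [completeH, pStar, e1, e2, e3]
  simp [completeH, e1]
  field_simp
  ring

theorem schurStar_one_one_one (hq : q ≠ 0) (hq2 : q ^ 2 ≠ 1) (hq4 : q ^ 4 ≠ 1) (hq6 : q ^ 6 ≠ 1)
    (hA : A ≠ 0) :
    schurStar A q [1, 1, 1] = schurStar A q [1] *
      ((A * q⁻¹ - (A * q⁻¹)⁻¹) * (A * (q ^ 2)⁻¹ - (A * (q ^ 2)⁻¹)⁻¹) /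
        ((q ^ 2 - (q ^ 2)⁻¹) * (q ^ 3 - (q ^ 3)⁻¹))) := by
  have h1 : q ^ 2 - 1 ≠ 0 := sub_ne_zero.2 hq2
  have h2 := sq_add_one_ne_zero hq4
  have h3 := quartic_ne_zero hq6
  have e1 : q - q⁻¹ = (q ^ 2 - 1) / q := by field_simp
  have e2 : q ^ 2 - (q ^ 2)⁻¹ = (q ^ 2 - 1) * (q ^ 2 + 1) / q ^ 2 := by field_simp; ring
  have e3 : q ^ 3 - (q ^ 3)⁻¹ = (q ^ 2 - 1) * (q ^ 2 * (q ^ 2 + 1) + 1) / q ^ 3 := by field_simp; ring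
  have h : schurStar A q [1, 1, 1] = completeH (pStar A q) 1 ^ 3 -
      2 * completeH (pStar A q) 1 * completeH (pStar A q) 2 + completeH (pStar A q) 3 := by
    have h0 : completeH (pStar A q) 0 = 1 := by simp [completeH]
    simp [schurStar, schur, Matrix.det_fin_three, h0]
    ring
  rw [h, completeH_pStar_three hq hq2 hq4 hq6 hA, completeH_pStar_two hq hq2 hq4 hA, schurStar_one]
  simp only [completeH, pStar, e1, e2, e3]
  simp [completeH, e1]
  field_simp
  ring

end Generic

/-! ### The mixing matrix -/

section Mixing

variable {K : Type*} [Field K] {q s : K}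

/-- `C² + S² = 1` because `[2]² = 1 + [3]`. -/
theorem mixing_mul_transpose (hq : q ≠ 0) (hq2 : q ^ 2 ≠ 1) (hq4 : q ^ 4 ≠ 1)
    (hs : s ^ 2 = qNum q 3) : mixing q s * (mixing q s)ᵀ = 1 := by
  have h2 := sq_add_one_ne_zero hq4
  rw [qNum_three hq hq2, eq_div_iff (pow_ne_zero 2 hq)] at hs
  rw [mixing_eq hq hq2]
  ext i j
  fin_cases i <;> fin_cases j <;> simp [Matrix.mul_apply, Fin.sum_univ_two]
  · field_simp
    linear_combination hs
  · ring
  · ring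
  · field_simp
    linear_combination hs

/-- `diag (q, -1/q)` as an invertible matrix. -/
def rHatUnit (q : K) (hq : q ≠ 0) : (Matrix (Fin 2) (Fin 2) K)ˣ where
  val := rHat q
  inv := !![q⁻¹, 0; 0, -q]
  val_inv := by simp [rHat, Matrix.one_fin_two, hq]
  inv_val := by simp [rHat, Matrix.one_fin_two, hq]

/-- The mixing matrix as an invertible matrix. -/
def mixingUnit (q s : K) (h : mixing q s * (mixing q s)ᵀ = 1) : (Matrix (Fin 2) (Fin 2) K)ˣ where
  val := mixing q s
  inv := (mixing q s)ᵀ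
  val_inv := h
  inv_val := mul_eq_one_comm.1 h

theorem rHatUnit_zpow (hq : q ≠ 0) (k : ℤ) :
    ((rHatUnit q hq ^ k : (Matrix (Fin 2) (Fin 2) K)ˣ) : Matrix (Fin 2) (Fin 2) K) =
      !![q ^ k, 0; 0, (-q⁻¹) ^ k] := by
  have hq' : -q⁻¹ ≠ 0 := neg_ne_zero.2 (inv_ne_zero hq)
  have e : ((rHatUnit q hq)⁻¹ : (Matrix (Fin 2) (Fin 2) K)ˣ) = !![q⁻¹, 0; 0, -q] := rfl
  have e' : (rHatUnit q hq : Matrix (Fin 2) (Fin 2) K) = rHat q := rfl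
  induction k with
  | zero => simp [Matrix.one_fin_two]
  | succ n ih =>
    rw [zpow_add_one, Units.val_mul, ih, e', rHat]
    simp [zpow_add_one₀ hq, zpow_add_one₀ hq']
  | pred n ih =>
    rw [zpow_sub_one, Units.val_mul, ih, e]
    simp [zpow_sub_one₀ hq, zpow_sub_one₀ hq']

theorem coe_zpow_unit {n : Type*} [Fintype n] [DecidableEq n] (u : (Matrix n n K)ˣ) (k : ℤ) :
    ((u ^ k : (Matrix n n K)ˣ) : Matrix n n K) = (u : Matrix n n K) ^ k :=
  Matrix.coe_units_zpow u k

theorem mixing_conj (hq : q ≠ 0) (hq2 : q ^ 2 ≠ 1) (hq4 : q ^ 4 ≠ 1)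
    (hs : s ^ 2 = qNum q 3) :
    mixing q s * rHat q * (mixing q s)ᵀ =
      !![-(q * (q ^ 2 + 1))⁻¹, -(s * q / (q ^ 2 + 1)); -(s * q / (q ^ 2 + 1)),
        q ^ 3 / (q ^ 2 + 1)] := by
  have h2 := sq_add_one_ne_zero hq4
  rw [qNum_three hq hq2, eq_div_iff (pow_ne_zero 2 hq)] at hs
  rw [mixing_eq hq hq2, rHat]
  ext i j
  fin_cases i <;> fin_cases j <;> simp [Matrix.mul_apply, Fin.sum_univ_two]
  · field_simp
    linear_combination -hs
  · field_simp
    ring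
  · field_simp
    ring
  · field_simp
    linear_combination hs

/-- Orthogonality alone would not suffice: the relation depends on the angle `C = 1/[2]`. It is
checked entrywise, and `s² = [3]` enters on the diagonal. -/
theorem mixing_braid (hq : q ≠ 0) (hq2 : q ^ 2 ≠ 1) (hq4 : q ^ 4 ≠ 1) (hs : s ^ 2 = qNum q 3) :
    rHat q * (mixing q s * rHat q * (mixing q s)ᵀ) * rHat q =
      (mixing q s * rHat q * (mixing q s)ᵀ) * rHat q *
        (mixing q s * rHat q * (mixing q s)ᵀ) := by
  have h2 := sq_add_one_ne_zero hq4
  rw [mixing_conj hq hq2 hq4 hs]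
  rw [qNum_three hq hq2, eq_div_iff (pow_ne_zero 2 hq)] at hs
  rw [rHat]
  ext i j
  fin_cases i <;> fin_cases j <;> simp [Matrix.mul_apply, Fin.sum_univ_two]
  · field_simp
    linear_combination hs
  · field_simp
    ring
  · field_simp
    ring
  · field_simp
    linear_combination -hs

/-- The representation of the three-strand braid group in the sector `[21]`. -/
def rep21 (q s : K) (hq : q ≠ 0) (hq2 : q ^ 2 ≠ 1) (hq4 : q ^ 4 ≠ 1) (hs : s ^ 2 = qNum q 3) :
    Braid 2 →* (Matrix (Fin 2) (Fin 2) K)ˣ :=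
  braidRep (rHatUnit q hq)
    (mixingUnit q s (mixing_mul_transpose hq hq2 hq4 hs) * rHatUnit q hq *
      (mixingUnit q s (mixing_mul_transpose hq hq2 hq4 hs))⁻¹)
    (Units.ext (mixing_braid hq hq2 hq4 hs))

variable (hq : q ≠ 0) (hq2 : q ^ 2 ≠ 1) (hq4 : q ^ 4 ≠ 1) (hs : s ^ 2 = qNum q 3)

theorem coeff21_eq_trace_rep21 (L : List (ℤ × ℤ)) :
    coeff21 q s L = Matrix.trace (rep21 q s hq hq2 hq4 hs (braidOf L)).val := by
  rw [map_braidOf, coeff21]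
  congr 1
  rw [← Units.coeHom_apply, map_list_prod, List.map_map]
  congr 2
  funext p
  simp only [Function.comp_apply, Units.coeHom_apply, rep21, braidRep_zero, braidRep_one,
    conj_zpow, Units.val_mul, coe_zpow_unit]
  rfl

theorem rHat_sub_inv (hq : q ≠ 0) : (rHatUnit q hq : Matrix (Fin 2) (Fin 2) K) -
    ((rHatUnit q hq)⁻¹ : (Matrix (Fin 2) (Fin 2) K)ˣ) = (q - q⁻¹) • 1 := by
  change rHat q - !![q⁻¹, 0; 0, -q] = _
  ext i j
  fin_cases i <;> fin_cases j <;> simp [rHat]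
  ring

theorem rep21_hecke (i : Fin 2) :
    ((rep21 q s hq hq2 hq4 hs (sigma i)).val : Matrix (Fin 2) (Fin 2) K) -
      ((rep21 q s hq hq2 hq4 hs (sigma i))⁻¹).val = (q - q⁻¹) • 1 := by
  fin_cases i
  · simpa [rep21] using rHat_sub_inv hq
  · simp only [rep21, Fin.mk_one, braidRep_one, mul_inv_rev, inv_inv, Units.val_mul]
    rw [← mul_assoc, ← sub_mul, ← mul_sub, rHat_sub_inv hq, mul_smul_comm, mul_one, smul_mul_assoc,
      Units.mul_inv]

theorem isHeckeTrace_rep21 :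
    IsHeckeTrace q fun β => Matrix.trace (rep21 q s hq hq2 hq4 hs β).val :=
  IsHeckeTrace.of_rep (rep21 q s hq hq2 hq4 hs) (Matrix.traceLinearMap (Fin 2) K K)
    (fun α β => by simpa using Matrix.trace_mul_comm (rep21 q s hq hq2 hq4 hs α).val _) (rep21_hecke hq hq2 hq4 hs)

end Mixing

/-! ### Fusion bases of the highest weight vectors of `[21]` -/

section Fusion

variable {K : Type*} [Field K] {q s : K}

/-- The vector `x T_1 T_0 T_0 + y T_0 T_1 T_0 + z T_0 T_0 T_1` of `[1]^{⊗ 3}`. -/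
def oneDown (x y z : K) : (Fin 2 × Fin 2) × Fin 2 → K := fun i =>
  if i = ((1, 0), 0) then x else if i = ((0, 1), 0) then y else if i = ((0, 0), 1) then z else 0

theorem oneDown_dotProduct (x y z x' y' z' : K) :
    oneDown x y z ⬝ᵥ oneDown x' y' z' = x * x' + y * y' + z * z' := by
  simp [dotProduct, Fintype.sum_prod_type, Fin.sum_univ_two, oneDown]
  ring

theorem oneDown_add (x y z x' y' z' : K) :
    oneDown x y z + oneDown x' y' z' = oneDown (x + x') (y + y') (z + z') := by
  funext i
  simp only [Pi.add_apply, oneDown]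
  split_ifs <;> simp

theorem smul_oneDown (c x y z : K) : c • oneDown x y z = oneDown (c * x) (c * y) (c * z) := by
  funext i
  simp only [Pi.smul_apply, oneDown]
  split_ifs <;> simp

theorem neg_oneDown (x y z : K) : -oneDown x y z = oneDown (-x) (-y) (-z) := by
  rw [← neg_one_smul K, smul_oneDown]
  simp

theorem rLeft_mulVec_oneDown (x y z : K) :
    rLeft 2 q *ᵥ oneDown x y z = oneDown y (x + (q - q⁻¹) * y) (q * z) := by
  funext ⟨⟨i, j⟩, k⟩
  fin_cases i <;> fin_cases j <;> fin_cases k <;>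
    simp [Matrix.mulVec, dotProduct, Fintype.sum_prod_type, Fin.sum_univ_two, oneDown, rLeft,
      rMatrix, Matrix.one_apply]
  ring

theorem rRight_mulVec_oneDown (x y z : K) :
    rRight 2 q *ᵥ oneDown x y z = oneDown (q * x) z (y + (q - q⁻¹) * z) := by
  funext ⟨⟨i, j⟩, k⟩
  fin_cases i <;> fin_cases j <;> fin_cases k <;>
    simp [Matrix.mulVec, dotProduct, Fintype.sum_prod_type, Fin.sum_univ_two, oneDown, rRight,
      rMatrix, Matrix.one_apply]
  ring

/-- A basis tensor with `k` factors `T_1` has weight `q^{2k-3}`. Since `q² ≠ 1` and `q⁴ ≠ 1`, only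
`k = 1` gives `q⁻¹`. On that three-dimensional space `E` takes values in the line of `T_0 T_0 T_0`,
so its kernel is cut out by one equation. -/
theorem mem_highestWeight21 (hq : q ≠ 0) (hq2 : q ^ 2 ≠ 1) (hq4 : q ^ 4 ≠ 1)
    (w : (Fin 2 × Fin 2) × Fin 2 → K) :
    w ∈ highestWeight21 q ↔ ∃ x y z, w = oneDown x y z ∧ x + q * y + q ^ 2 * z = 0 := by
  have cartan : ∀ i, ((cartanCube q - q⁻¹ • (1 : Matrix _ _ K)) *ᵥ w) i =
      (cartanCube q i i - q⁻¹) * w i := by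
    intro i
    rw [Matrix.mulVec, dotProduct, Finset.sum_eq_single i]
    · simp
    · rintro ⟨⟨j, k⟩, l⟩ - h
      obtain ⟨⟨j', k'⟩, l'⟩ := i
      revert h
      fin_cases j <;> fin_cases k <;> fin_cases l <;> fin_cases j' <;> fin_cases k' <;>
        fin_cases l' <;> simp [cartanCube, cartanOne]
    · simp
  have hraise : ∀ x y z, (raiseCube q *ᵥ oneDown x y z = 0) ↔ x + q * y + q ^ 2 * z = 0 := by
    intro x y z
    have e : raiseCube q *ᵥ oneDown x y z =
        Pi.single ((0, 0), 0) ((x + q * y + q ^ 2 * z) / q ^ 2) := by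
      funext ⟨⟨i, j⟩, k⟩
      fin_cases i <;> fin_cases j <;> fin_cases k <;>
        simp [Matrix.mulVec, dotProduct, Fintype.sum_prod_type, Fin.sum_univ_two, oneDown,
          raiseCube, raiseOne, cartanOne, Matrix.one_apply]
      field_simp
      ring
    rw [e, Pi.single_eq_zero_iff]
    simp [hq]
  rw [highestWeight21, Submodule.mem_inf, LinearMap.mem_ker, LinearMap.mem_ker,
    Matrix.mulVecLin_apply, Matrix.mulVecLin_apply]
  constructor
  · rintro ⟨h1, h2⟩
    have hw : w = oneDown (w ((1, 0), 0)) (w ((0, 1), 0)) (w ((0, 0), 1)) := by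
      have h : ∀ i, cartanCube q i i ≠ q⁻¹ → w i = 0 := fun i hi => by
        have := congrFun h2 i
        rw [cartan] at this
        exact (mul_eq_zero.1 this).resolve_left (sub_ne_zero.2 hi)
      have a1 : q⁻¹ * q⁻¹ ≠ 1 := fun h => hq2 (by
        field_simp at h
        exact h.symm)
      have a2 : q ≠ q⁻¹ := fun h => hq2 (by
        field_simp at h
        exact h)
      have a3 : q * q * q ≠ q⁻¹ := fun h => hq4 (by
        field_simp at h
        exact h)
      funext ⟨⟨i, j⟩, k⟩
      fin_cases i <;> fin_cases j <;> fin_cases k <;> simp [oneDown] <;> apply h <;>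
        simp [cartanCube, cartanOne, hq, a1, a2, a3]
    refine ⟨_, _, _, hw, ?_⟩
    rw [hw] at h1
    exact (hraise _ _ _).1 h1
  · rintro ⟨x, y, z, rfl, h⟩
    refine ⟨(hraise x y z).2 h, ?_⟩
    funext ⟨⟨i, j⟩, k⟩
    rw [cartan]
    fin_cases i <;> fin_cases j <;> fin_cases k <;> simp [oneDown, cartanCube, cartanOne, hq]

theorem isMixingMatrix_mixing (hq : q ≠ 0) (hq2 : q ^ 2 ≠ 1) (hq4 : q ^ 4 ≠ 1) (hq6 : q ^ 6 ≠ 1)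
    (hs : s ^ 2 = qNum q 3) : IsMixingMatrix q (mixing q s) := by
  have hU := mixing_mul_transpose hq hq2 hq4 hs
  have hU' : (mixing q s)ᵀ * mixing q s = 1 := mul_eq_one_comm.1 hU
  have h2 := sq_add_one_ne_zero hq4
  have h3 := quartic_ne_zero hq6
  have hs' := hs
  rw [qNum_three hq hq2, eq_div_iff (pow_ne_zero 2 hq)] at hs'
  have hs0 : s ≠ 0 := by
    rintro rfl
    exact h3 (by linear_combination -hs')
  -- The eigenvalue of `R ⊗ I` fixes the ratio of the first two coordinates, and `x + qy + q²z = 0`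
  -- fixes the third. The factor `s` equalizes the square norms; its sign is the one for which `U`
  -- leads to eigenvectors of `I ⊗ R`.
  let b : Fin 2 → ((Fin 2 × Fin 2) × Fin 2 → K) :=
    ![oneDown 1 q (-(q ^ 2 + 1) / q ^ 2), oneDown (-s) (s / q) 0]
  -- With `c` defined through `U`, what remains to be shown is that it diagonalizes `I ⊗ R` and
  -- inherits span and orthogonality from `b`.
  let c : Fin 2 → ((Fin 2 × Fin 2) × Fin 2 → K) := fun j => ∑ i, mixing q s i j • b i
  let ν : K := (1 + q ^ 2) * s ^ 2 / q ^ 2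
  have hb : ∀ i j, b i ⬝ᵥ b j = if i = j then ν else 0 := by
    intro i j
    fin_cases i <;> fin_cases j <;> simp [b, ν, oneDown_dotProduct]
    · field_simp
      linear_combination -(1 + q ^ 2) * hs'
    · field_simp
      ring
    · field_simp
      ring
    · field_simp
      ring
  have hspan : Submodule.span K (Set.range b) = highestWeight21 q := by
    apply le_antisymm
    · rw [Submodule.span_le]
      rintro _ ⟨i, rfl⟩
      rw [SetLike.mem_coe, mem_highestWeight21 hq hq2 hq4]
      fin_cases i
      · refine ⟨_, _, _, rfl, ?_⟩
        field_simp
        ring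
      · refine ⟨_, _, _, rfl, ?_⟩
        field_simp
        ring
    · intro w hw
      obtain ⟨x, y, z, rfl, h⟩ := (mem_highestWeight21 hq hq2 hq4 _).1 hw
      -- Only `b 0` has a `z`-coordinate, which gives its coefficient; then `x` gives that of `b 1`.
      have e : oneDown x y z = (-z * q ^ 2 / (q ^ 2 + 1)) • b 0 +
          ((-x - z * q ^ 2 / (q ^ 2 + 1)) / s) • b 1 := by
        simp only [b, Matrix.cons_val_zero, Matrix.cons_val_one, smul_oneDown, oneDown_add]
        congr 1
        · field_simp
          ring
        · field_simp
          linear_combination (q ^ 2 + 1) * h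
        · field_simp
          ring
      rw [e]
      exact add_mem (Submodule.smul_mem _ _ (Submodule.subset_span ⟨0, rfl⟩))
        (Submodule.smul_mem _ _ (Submodule.subset_span ⟨1, rfl⟩))
  have hbc : ∀ i, b i = ∑ j, mixing q s i j • c j := by
    intro i
    have h : ∀ k, ∑ j, mixing q s i j * mixing q s k j = (1 : Matrix (Fin 2) (Fin 2) K) i k :=
      fun k => by rw [← hU, Matrix.mul_apply]; rfl
    simp only [c, Finset.smul_sum, smul_smul]
    rw [Finset.sum_comm]
    simp only [← Finset.sum_smul, h, Matrix.one_apply, ite_smul, one_smul, zero_smul,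
      Finset.sum_ite_eq, Finset.mem_univ, if_true]
  refine ⟨b, c, ν, ?_, hspan, ?_, hb, ?_, ?_, ?_, fun _ => rfl⟩
  · have : 1 + q ^ 2 ≠ 0 := by rwa [add_comm]
    positivity
  · rw [← hspan]
    apply le_antisymm <;> rw [Submodule.span_le] <;> rintro _ ⟨i, rfl⟩
    · exact Submodule.sum_mem _ fun j _ =>
        Submodule.smul_mem _ _ (Submodule.subset_span ⟨j, rfl⟩)
    · rw [hbc]
      exact Submodule.sum_mem _ fun j _ =>
        Submodule.smul_mem _ _ (Submodule.subset_span ⟨j, rfl⟩)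
  · intro i j
    have h : ∑ k, mixing q s k i * mixing q s k j = (1 : Matrix (Fin 2) (Fin 2) K) i j := by
      rw [← hU', Matrix.mul_apply]; rfl
    rw [show (if i = j then ν else 0) = ν * (1 : Matrix (Fin 2) (Fin 2) K) i j by
      simp [Matrix.one_apply], ← h, Finset.mul_sum]
    simp only [c, sum_dotProduct, dotProduct_sum, smul_dotProduct, dotProduct_smul, hb, smul_eq_mul,
      mul_ite, mul_zero, Finset.sum_ite_eq', Finset.mem_univ, if_true]
    exact Finset.sum_congr rfl fun k _ => by ring
  · intro i
    fin_cases i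
    · simp only [b, Fin.zero_eta, Matrix.cons_val_zero, rLeft_mulVec_oneDown, smul_oneDown, rHat,
        Matrix.of_apply, Matrix.cons_val', Matrix.cons_val_fin_one]
      congr 1
      · ring
      · field_simp
        ring
    · simp only [b, Fin.mk_one, Matrix.cons_val_one, rLeft_mulVec_oneDown, smul_oneDown, rHat,
        Matrix.of_apply, Matrix.cons_val', Matrix.cons_val_fin_one]
      congr 1
      · field_simp
      · field_simp
        ring
      · ring
  · intro j
    -- In coordinates `c 1` is `T_0` tensored with a `-1/q` eigenvector of `R`, and `c 0` has last
    -- two coordinates in the ratio `1 : q`, as the eigenvalue `q` requires.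
    have hU00 : c j = ![oneDown ((1 + s ^ 2) * q / (q ^ 2 + 1)) (-q⁻¹ ^ 2) (-q⁻¹),
        oneDown 0 s (-s / q)] j := by
      simp only [c, mixing_eq hq hq2, Fin.sum_univ_two, b]
      fin_cases j
      · simp [smul_oneDown, oneDown_add, neg_oneDown]
        congr 1
        · field_simp
        · field_simp
          linear_combination -hs'
        · field_simp
          ring
      · simp [smul_oneDown, oneDown_add]
        congr 1
        · field_simp
          ring
        · field_simp
        · field_simp
          ring
    rw [hU00]
    fin_cases j
    · simp [rRight_mulVec_oneDown, smul_oneDown, rHat]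
      congr 1
      · field_simp
      · field_simp
        ring
    · simp [rRight_mulVec_oneDown, smul_oneDown, rHat, neg_oneDown]
      congr 1
      · field_simp
      · field_simp
        ring

end Fusion

/-! ### The HOMFLY polynomial on at most three strands -/

section Homfly

variable {K : Type*} [Field K] {q s A : K}

theorem neg_inv_ne_zero (hq : q ≠ 0) : -q⁻¹ ≠ 0 := neg_ne_zero.2 (inv_ne_zero hq)

variable (hq : q ≠ 0) (hq2 : q ^ 2 ≠ 1) (hq4 : q ^ 4 ≠ 1) (hs : s ^ 2 = qNum q 3)

/-- The character expansion divided by `S_1^*`, as a function on the three-strand braid group. -/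
def reducedExpansion (A : K) (β : Braid 2) : K :=
  (braidChar (Units.mk0 q hq) 2 β : K) *
      ((A * q - (A * q)⁻¹) * (A * q ^ 2 - (A * q ^ 2)⁻¹) /
        ((q ^ 2 - (q ^ 2)⁻¹) * (q ^ 3 - (q ^ 3)⁻¹))) +
    (braidChar (Units.mk0 (-q⁻¹) (neg_inv_ne_zero hq)) 2 β : K) *
      ((A * q⁻¹ - (A * q⁻¹)⁻¹) * (A * (q ^ 2)⁻¹ - (A * (q ^ 2)⁻¹)⁻¹) /
        ((q ^ 2 - (q ^ 2)⁻¹) * (q ^ 3 - (q ^ 3)⁻¹))) +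
    Matrix.trace (rep21 q s hq hq2 hq4 hs β).val *
      ((A * q - (A * q)⁻¹) * (A * q⁻¹ - (A * q⁻¹)⁻¹) / ((q - q⁻¹) * (q ^ 3 - (q ^ 3)⁻¹)))

theorem characterExpansion_eq [CharZero K] (hq6 : q ^ 6 ≠ 1) (hA : A ≠ 0) (L : List (ℤ × ℤ)) :
    characterExpansion q s A L =
      schurStar A q [1] * reducedExpansion hq hq2 hq4 hs A (braidOf L) := by
  rw [characterExpansion, schurStar_three hq hq2 hq4 hq6 hA,
    schurStar_one_one_one hq hq2 hq4 hq6 hA, schurStar_two_one hq hq2 hq4 hq6 hA, reducedExpansion,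
    coeff21_eq_trace_rep21 hq hq2 hq4 hs, braidChar_braidOf, braidChar_braidOf,
    Units.val_zpow_eq_zpow_val, Units.val_zpow_eq_zpow_val, Units.val_mk0, Units.val_mk0]
  ring

theorem isHeckeTrace_reducedExpansion (A : K) :
    IsHeckeTrace q (reducedExpansion hq hq2 hq4 hs A) := by
  have h1 := (IsHeckeTrace.braidChar (q := q) (Units.mk0 q hq) (by simp)).smul
    ((A * q - (A * q)⁻¹) * (A * q ^ 2 - (A * q ^ 2)⁻¹) /
        ((q ^ 2 - (q ^ 2)⁻¹) * (q ^ 3 - (q ^ 3)⁻¹)))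
  have h2 := (IsHeckeTrace.braidChar (q := q) (Units.mk0 (-q⁻¹) (neg_inv_ne_zero hq))
    (by simp [inv_neg]; ring)).smul
    ((A * q⁻¹ - (A * q⁻¹)⁻¹) * (A * (q ^ 2)⁻¹ - (A * (q ^ 2)⁻¹)⁻¹) /
        ((q ^ 2 - (q ^ 2)⁻¹) * (q ^ 3 - (q ^ 3)⁻¹)))
  have h3 := (isHeckeTrace_rep21 hq hq2 hq4 hs).smul
    ((A * q - (A * q)⁻¹) * (A * q⁻¹ - (A * q⁻¹)⁻¹) / ((q - q⁻¹) * (q ^ 3 - (q ^ 3)⁻¹)))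
  convert (h1.add h2).add h3 using 1
  funext β
  simp only [reducedExpansion, Pi.add_apply, Pi.smul_apply, smul_eq_mul]
  ring

/-- The HOMFLY polynomial on closed braids with at most three strands, and zero on braids with
more strands. -/
def homflyThree (A : K) (hA : A ≠ 0) : ∀ n : ℕ, Braid n → K
  | 0, _ => 1
  -- Two strands: the expansion over `[2]` and `[11]`, with coefficients `S_2^*/S_1^*` and
  -- `S_11^*/S_1^*`. The power of `A` removes the framing factor.
  | 1, β => (braidChar (Units.mk0 A hA)⁻¹ 1 β : K) *
      ((braidChar (Units.mk0 q hq) 1 β : K) * ((A * q - (A * q)⁻¹) / (q ^ 2 - (q ^ 2)⁻¹)) +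
        (braidChar (Units.mk0 (-q⁻¹) (neg_inv_ne_zero hq)) 1 β : K) *
          ((A * q⁻¹ - (A * q⁻¹)⁻¹) / (q ^ 2 - (q ^ 2)⁻¹)))
  | 2, β => (braidChar (Units.mk0 A hA)⁻¹ 2 β : K) * reducedExpansion hq hq2 hq4 hs A β
  | _ + 3, _ => 0

theorem rep21_zero_zpow_one (k : ℤ) :
    (rep21 q s hq hq2 hq4 hs (sigma 0 ^ k * sigma 1)).val =
      !![q ^ k, 0; 0, (-q⁻¹) ^ k] * !![-(q * (q ^ 2 + 1))⁻¹, -(s * q / (q ^ 2 + 1));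
        -(s * q / (q ^ 2 + 1)), q ^ 3 / (q ^ 2 + 1)] := by
  rw [map_mul, map_zpow, Units.val_mul, ← mixing_conj hq hq2 hq4 hs, ← rHatUnit_zpow hq]
  simp only [rep21, braidRep_zero, braidRep_one]
  rfl

theorem trace_rep21_zero_zpow (k : ℤ) :
    Matrix.trace (rep21 q s hq hq2 hq4 hs (sigma 0 ^ k)).val = q ^ k + (-q⁻¹) ^ k := by
  rw [map_zpow, rep21, braidRep_zero, rHatUnit_zpow hq]
  simp [Matrix.trace_fin_two]

theorem trace_rep21_zero_zpow_one (k : ℤ) :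
    Matrix.trace (rep21 q s hq hq2 hq4 hs (sigma 0 ^ k * sigma 1)).val =
      (-q⁻¹) ^ k * (q ^ 3 / (q ^ 2 + 1)) - q ^ k * (q * (q ^ 2 + 1))⁻¹ := by
  rw [rep21_zero_zpow_one]
  simp [Matrix.trace_fin_two]
  ring

theorem isHomfly_homflyThree (hq6 : q ^ 6 ≠ 1) (hA : A ≠ 0) :
    IsHomfly A q 3 (homflyThree hq hq2 hq4 hs A hA) := by
  have h1 : q ^ 2 - 1 ≠ 0 := sub_ne_zero.2 hq2
  have h2 := sq_add_one_ne_zero hq4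
  have h3 := quartic_ne_zero hq6
  have e1 : q - q⁻¹ = (q ^ 2 - 1) / q := by field_simp
  have e2 : q ^ 2 - (q ^ 2)⁻¹ = (q ^ 2 - 1) * (q ^ 2 + 1) / q ^ 2 := by field_simp; ring
  have e3 : q ^ 3 - (q ^ 3)⁻¹ = (q ^ 2 - 1) * (q ^ 2 * (q ^ 2 + 1) + 1) / q ^ 3 := by
    field_simp; ring
  have hH := isHeckeTrace_reducedExpansion hq hq2 hq4 hs A
  have hpos : ∀ k : ℤ, homflyThree hq hq2 hq4 hs A hA 2 (sigma 0 ^ k * sigma 1) =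
      homflyThree hq hq2 hq4 hs A hA 1 (sigma 0 ^ k) := by
    intro k
    simp only [homflyThree, reducedExpansion, trace_rep21_zero_zpow_one]
    simp only [map_mul, map_zpow, braidChar_sigma, Units.val_mul, Units.val_zpow_eq_zpow_val, Units.val_mk0,
      Units.val_inv_eq_inv_val, e1, e2, e3]
    -- The identity is linear in `q^k` and `(-1/q)^k`, and holds with these treated as independent
    -- variables.
    generalize q ^ k = x
    generalize (-q⁻¹) ^ k = y
    generalize A⁻¹ ^ k = z
    field_simp
    ring
  have hneg : ∀ k : ℤ, homflyThree hq hq2 hq4 hs A hA 2 (sigma 0 ^ k * (sigma 1)⁻¹) =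
      homflyThree hq hq2 hq4 hs A hA 1 (sigma 0 ^ k) := by
    intro k
    -- The Hecke skein relation expresses the negative stabilization through the positive one and
    -- the unstabilized word.
    have h := hH.skein 1 (sigma 0 ^ k)
    rw [sub_eq_iff_eq_add', ← sub_eq_iff_eq_add] at h
    simp only [homflyThree, ← h]
    simp only [reducedExpansion, trace_rep21_zero_zpow_one, trace_rep21_zero_zpow]
    simp only [map_mul, map_zpow, map_inv, braidChar_sigma, Units.val_mul, Units.val_zpow_eq_zpow_val, Units.val_mk0,
      Units.val_inv_eq_inv_val, e1, e2, e3]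
    generalize q ^ k = x
    generalize (-q⁻¹) ^ k = y
    generalize A⁻¹ ^ k = z
    field_simp
    ring
  refine ⟨rfl, ?_, ?_, ?_, ?_⟩
  · intro n hn α β
    have hn : n < 3 := by exact_mod_cast hn
    interval_cases n
    · rfl
    · simp only [homflyThree, map_mul, Units.val_mul, mul_comm]
    · simp only [homflyThree, map_mul, hH.comm α β, mul_comm]
  · intro n hn β
    have hn : n + 1 < 3 := by exact_mod_cast hn
    have hn : n < 2 := by omega
    interval_cases n
    · obtain rfl := braid_zero_eq_one β
      simp only [homflyThree, map_one, one_mul, braidChar_sigma, Units.val_mk0,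
        Units.val_inv_eq_inv_val, e2]
      field_simp
      ring
    · obtain ⟨k, rfl⟩ := braid_one_eq_zpow β
      rw [map_zpow, addStrand_sigma]
      exact hpos k
  · intro n hn β
    have hn : n + 1 < 3 := by exact_mod_cast hn
    have hn : n < 2 := by omega
    interval_cases n
    · obtain rfl := braid_zero_eq_one β
      simp only [homflyThree, map_one, one_mul, map_inv, braidChar_sigma, Units.val_mk0,
        Units.val_inv_eq_inv_val, e2]
      field_simp
      ring
    · obtain ⟨k, rfl⟩ := braid_one_eq_zpow β
      rw [map_zpow, addStrand_sigma]
      exact hneg k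
  · intro n hn i β
    have hn : n < 3 := by exact_mod_cast hn
    interval_cases n
    · exact i.elim0
    · simp only [homflyThree, map_mul, map_inv, braidChar_sigma, Units.val_mul, Units.val_mk0,
        Units.val_inv_eq_inv_val]
      field_simp
      ring
    · have h := hH.skein i β
      simp only [homflyThree, map_mul, map_inv, braidChar_sigma, Units.val_mul, Units.val_mk0,
        Units.val_inv_eq_inv_val, inv_inv]
      linear_combination (braidChar (Units.mk0 A hA)⁻¹ 2 β : K) * h +
        (braidChar (Units.mk0 A hA)⁻¹ 2 β : K) *
          (reducedExpansion hq hq2 hq4 hs A (β * sigma i) -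
            reducedExpansion hq hq2 hq4 hs A (β * (sigma i)⁻¹)) * mul_inv_cancel₀ hA

/-- The values of the reduced expansion that determine it as a Hecke trace. -/
theorem reducedExpansion_values (hq6 : q ^ 6 ≠ 1) (hA : A ≠ 0) :
    reducedExpansion hq hq2 hq4 hs A 1 = ((A - A⁻¹) / (q - q⁻¹)) ^ 2 ∧
    reducedExpansion hq hq2 hq4 hs A (sigma 1) = A * ((A - A⁻¹) / (q - q⁻¹)) ∧
    reducedExpansion hq hq2 hq4 hs A (sigma 0 * sigma 1) = A ^ 2 := by
  -- No evaluation is needed: `homflyThree` is a HOMFLY polynomial, so its values at these three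
  -- braids are forced.
  have hP := isHomfly_homflyThree hq hq2 hq4 hs hq6 hA
  have hz := sub_inv_ne_zero hq hq2
  refine ⟨?_, ?_, ?_⟩
  · have h := hP.unlink_three le_rfl hz
    simpa [homflyThree] using h
  · have h := hP.unlink_two_three le_rfl hz
    simp only [homflyThree, braidChar_sigma, Units.val_mk0, Units.val_inv_eq_inv_val] at h
    rw [← h, mul_inv_cancel_left₀ hA]
  · have h := hP.unknot_three le_rfl
    simp only [homflyThree, map_mul, Units.val_mul, braidChar_sigma, Units.val_mk0,
      Units.val_inv_eq_inv_val] at h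
    field_simp at h
    exact h

theorem IsHomfly.eq_reducedExpansion {M : ℕ∞} {P : ∀ n, Braid n → K} (hq6 : q ^ 6 ≠ 1)
    (hA : A ≠ 0) (hM : 3 ≤ M) (hP : IsHomfly A q M P) (L : List (ℤ × ℤ)) :
    A ^ expSum L * P 2 (braidOf L) = reducedExpansion hq hq2 hq4 hs A (braidOf L) := by
  obtain ⟨v1, v2, v3⟩ := reducedExpansion_values hq hq2 hq4 hs hq6 hA
  have hz := sub_inv_ne_zero hq hq2
  have hT := IsHomfly.isHeckeTrace (A := Units.mk0 A hA) hP hM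
  have h := hT.ext (isHeckeTrace_reducedExpansion hq hq2 hq4 hs A)
    (by simp [v1, hP.unlink_three hM hz]) (by simp [v2, hP.unlink_two_three hM hz])
    (by simp [v3, hP.unknot_three hM, sq])
  have h' := congrFun h (braidOf L)
  simpa [braidChar_braidOf] using h'

end Homfly

/-! ### The weighted trace of quantum `R`-matrices -/

section RMatrix

variable {K : Type*} [Field K] {N : ℕ} {q : K}

/-- The diagonal entries of the quantum `R`-matrix. -/
def rDiag (q : K) (i j : Fin N) : K := if i = j then q else if i < j then q - q⁻¹ else 0

/-- A row of `R` meets only `(i, j)` and `(j, i)`. Identities between products of `R`-matrices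
thereby become scalar ones, uniform in `N`. -/
theorem rMatrix_mulVec (v : Fin N × Fin N → K) (i j : Fin N) :
    (rMatrix N q *ᵥ v) (i, j) = rDiag q i j * v (i, j) + if i = j then 0 else v (j, i) := by
  have h : ∀ y, rMatrix N q (i, j) y =
      (if y = (i, j) then rDiag q i j else 0) + if y = (j, i) then (if i = j then 0 else 1) else 0 := by
    rintro ⟨k, l⟩
    simp only [rMatrix, rDiag, Matrix.of_apply, Prod.swap, Prod.mk.injEq]
    grind
  simp only [Matrix.mulVec, dotProduct, h, add_mul, Finset.sum_add_distrib, ite_mul, zero_mul,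
    Finset.sum_ite_eq', Finset.mem_univ, if_true, one_mul]

theorem rLeft_mul_apply {ι : Type*} (M : Matrix ((Fin N × Fin N) × Fin N) ι K) (i j k : Fin N)
    (y : ι) : (rLeft N q * M) ((i, j), k) y =
      rDiag q i j * M ((i, j), k) y + if i = j then 0 else M ((j, i), k) y := by
  rw [← rMatrix_mulVec fun p => M (p, k) y, Matrix.mul_apply, Fintype.sum_prod_type]
  simp [rLeft, Matrix.one_apply, Matrix.mulVec, dotProduct]

theorem rRight_mul_apply {ι : Type*} (M : Matrix ((Fin N × Fin N) × Fin N) ι K) (i j k : Fin N)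
    (y : ι) : (rRight N q * M) ((i, j), k) y =
      rDiag q j k * M ((i, j), k) y + if j = k then 0 else M ((i, k), j) y := by
  rw [← rMatrix_mulVec fun p => M ((i, p.1), p.2) y, Matrix.mul_apply, Fintype.sum_prod_type,
    Fintype.sum_prod_type]
  simp [rRight, Matrix.one_apply, Matrix.mulVec, dotProduct, Fintype.sum_prod_type]

theorem rLeft_mul_rLeft (hq : q ≠ 0) :
    rLeft N q * rLeft N q = 1 + (q - q⁻¹) • rLeft N q := by
  -- The trailing `1` gives every factor the shape to which `rLeft_mul_apply` applies; the same
  -- device recurs below.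
  have h : rLeft N q * (rLeft N q * 1) = 1 + (q - q⁻¹) • (rLeft N q * 1) := by
    ext ⟨⟨i, j⟩, k⟩ y
    simp only [Matrix.add_apply, Matrix.smul_apply, rLeft_mul_apply, smul_eq_mul]
    rcases lt_trichotomy i j with h | rfl | h
    · simp [rDiag, h.ne, h.ne', h, h.not_gt]
      ring
    · simp [rDiag]
      field_simp
      ring
    · simp [rDiag, h.ne, h.ne', h, h.not_gt]
      ring
  simpa using h

theorem rRight_mul_rRight (hq : q ≠ 0) :
    rRight N q * rRight N q = 1 + (q - q⁻¹) • rRight N q := by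
  have h : rRight N q * (rRight N q * 1) = 1 + (q - q⁻¹) • (rRight N q * 1) := by
    ext ⟨⟨k, i⟩, j⟩ y
    simp only [Matrix.add_apply, Matrix.smul_apply, rRight_mul_apply, smul_eq_mul]
    rcases lt_trichotomy i j with h | rfl | h
    · simp [rDiag, h.ne, h.ne', h, h.not_gt]
      ring
    · simp [rDiag]
      field_simp
      ring
    · simp [rDiag, h.ne, h.ne', h, h.not_gt]
      ring
  simpa using h

/-- The Yang–Baxter equation. -/
theorem rLeft_rRight_braid (hq : q ≠ 0) :
    rLeft N q * rRight N q * rLeft N q = rRight N q * rLeft N q * rRight N q := by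
  have h : rLeft N q * (rRight N q * (rLeft N q * 1)) =
      rRight N q * (rLeft N q * (rRight N q * 1)) := by
    ext ⟨⟨i, j⟩, k⟩ y
    simp only [rLeft_mul_apply, rRight_mul_apply]
    -- Only the relative order of the three indices matters; `omega` discards the inconsistent
    -- orders.
    rcases lt_trichotomy i j with h | h | h <;> rcases lt_trichotomy j k with h' | h' | h' <;>
    rcases lt_trichotomy i k with h'' | h'' | h'' <;> first
    | omega
    | (try subst h
       try subst h'
       try subst h''
       simp [rDiag, *, ne_of_lt, ne_of_gt, not_lt_of_gt]
       try field_simp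
       try ring)
  simpa [mul_assoc] using h

/-- `R ⊗ I` as an invertible matrix. -/
def rLeftUnit (N : ℕ) (q : K) (hq : q ≠ 0) :
    (Matrix ((Fin N × Fin N) × Fin N) ((Fin N × Fin N) × Fin N) K)ˣ where
  val := rLeft N q
  inv := rLeft N q - (q - q⁻¹) • 1
  val_inv := by rw [mul_sub, rLeft_mul_rLeft hq, mul_smul_comm, mul_one, add_sub_cancel_right]
  inv_val := by rw [sub_mul, rLeft_mul_rLeft hq, smul_mul_assoc, one_mul, add_sub_cancel_right]

/-- `I ⊗ R` as an invertible matrix. -/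
def rRightUnit (N : ℕ) (q : K) (hq : q ≠ 0) :
    (Matrix ((Fin N × Fin N) × Fin N) ((Fin N × Fin N) × Fin N) K)ˣ where
  val := rRight N q
  inv := rRight N q - (q - q⁻¹) • 1
  val_inv := by rw [mul_sub, rRight_mul_rRight hq, mul_smul_comm, mul_one, add_sub_cancel_right]
  inv_val := by rw [sub_mul, rRight_mul_rRight hq, smul_mul_assoc, one_mul, add_sub_cancel_right]

/-- The action of the three-strand braid group on `[1]^{⊗ 3}` by quantum `R`-matrices. -/
def rMatrixRep (N : ℕ) (q : K) (hq : q ≠ 0) :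
    Braid 2 →* (Matrix ((Fin N × Fin N) × Fin N) ((Fin N × Fin N) × Fin N) K)ˣ :=
  braidRep (rLeftUnit N q hq) (rRightUnit N q hq) (Units.ext (rLeft_rRight_braid hq))

/-- The diagonal entries of the weight matrix. -/
def weight (N : ℕ) (q : K) (i : ℕ) : K := q ^ ((N : ℤ) - 1 - 2 * (i : ℤ))

/-- The weight matrix on `[1]^{⊗ 3}`. -/
abbrev weightCube (N : ℕ) (q : K) :
    Matrix ((Fin N × Fin N) × Fin N) ((Fin N × Fin N) × Fin N) K :=
  (weightMatrix N q ⊗ₖ weightMatrix N q) ⊗ₖ weightMatrix N q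

theorem weightCube_eq : weightCube N q =
    Matrix.diagonal fun x => weight N q x.1.1 * weight N q x.1.2 * weight N q x.2 := by
  simp [weightCube, weightMatrix, Matrix.diagonal_kronecker_diagonal, weight]

/-- `R` mixes `(i, j)` only with `(j, i)`, which has the same weight. -/
theorem commute_weightCube_rLeft : Commute (weightCube N q) (rLeft N q) := by
  have h : weightCube N q * (rLeft N q * 1) = rLeft N q * (weightCube N q * 1) := by
    ext ⟨⟨i, j⟩, k⟩ y
    rw [weightCube_eq, Matrix.diagonal_mul, rLeft_mul_apply, rLeft_mul_apply, Matrix.diagonal_mul,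
      Matrix.diagonal_mul]
    split_ifs <;> ring
  simpa [Commute, SemiconjBy] using h

theorem commute_weightCube_rRight : Commute (weightCube N q) (rRight N q) := by
  have h : weightCube N q * (rRight N q * 1) = rRight N q * (weightCube N q * 1) := by
    ext ⟨⟨i, j⟩, k⟩ y
    rw [weightCube_eq, Matrix.diagonal_mul, rRight_mul_apply, rRight_mul_apply,
      Matrix.diagonal_mul, Matrix.diagonal_mul]
    split_ifs <;> ring
  simpa [Commute, SemiconjBy] using h

theorem commute_weightCube_rMatrixRep (hq : q ≠ 0) (β : Braid 2) :
    Commute (weightCube N q) (rMatrixRep N q hq β).val := by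
  have hβ : β ∈ Subgroup.closure (Set.range (sigma : Fin 2 → Braid 2)) := by
    rw [closure_range_sigma]; trivial
  induction hβ using Subgroup.closure_induction with
  | mem x hx =>
    obtain ⟨i, rfl⟩ := hx
    fin_cases i
    · simp only [rMatrixRep, Fin.zero_eta, braidRep_zero]
      exact commute_weightCube_rLeft
    · simp only [rMatrixRep, Fin.mk_one, braidRep_one]
      exact commute_weightCube_rRight
  | one => simp
  | mul x y _ _ hx hy =>
    rw [map_mul, Units.val_mul]
    exact hx.mul_right hy
  | inv x _ hx =>
    rw [map_inv]
    exact hx.units_inv_right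

/-- The weight commutes with the image of the braid group, so it can be carried past `ρ β` in a
cyclic rotation. -/
theorem isHeckeTrace_rMatrixRep (hq : q ≠ 0) :
    IsHeckeTrace q fun β => Matrix.trace (weightCube N q * (rMatrixRep N q hq β).val) := by
  refine IsHeckeTrace.of_rep (rMatrixRep N q hq)
    ((Matrix.traceLinearMap _ K K).comp (LinearMap.mulLeft K (weightCube N q))) ?_ ?_
  · intro α β
    simp only [LinearMap.comp_apply, LinearMap.mulLeft_apply, Matrix.traceLinearMap_apply]
    rw [← mul_assoc, Matrix.trace_mul_comm, ← mul_assoc,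
      ← (commute_weightCube_rMatrixRep hq β).eq, mul_assoc]
  · intro i
    fin_cases i
    · simp only [rMatrixRep, Fin.zero_eta, braidRep_zero]
      exact sub_sub_cancel _ _
    · simp only [rMatrixRep, Fin.mk_one, braidRep_one]
      exact sub_sub_cancel _ _

theorem homflyTrace_eq (hq : q ≠ 0) (L : List (ℤ × ℤ)) :
    homflyTrace N q L =
      Matrix.trace (weightCube N q * (rMatrixRep N q hq (braidOf L)).val) := by
  rw [map_braidOf, homflyTrace, ← Units.coeHom_apply, map_list_prod, List.map_map]
  congr 4
  funext p
  simp only [Function.comp_apply, Units.coeHom_apply, rMatrixRep, braidRep_zero, braidRep_one,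
    Units.val_mul, coe_zpow_unit]
  rfl

theorem sum_weight (hq : q ≠ 0) (hq2 : q ^ 2 ≠ 1) :
    ∑ i : Fin N, weight N q i = (q ^ N - (q ^ N)⁻¹) / (q - q⁻¹) := by
  have hz := sub_inv_ne_zero hq hq2
  -- Multiplied by `q - q⁻¹`, each weight is `q^{N-2i} - q^{N-2i-2}`, and the sum telescopes.
  have h : ∀ n : ℕ, (∑ i ∈ Finset.range n, weight N q i) * (q - q⁻¹) =
      q ^ N - q ^ N * (q ^ (2 * n))⁻¹ := by
    intro n
    induction n with
    | zero => simp
    | succ n ih =>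
      rw [Finset.sum_range_succ, add_mul, ih, weight, zpow_sub₀ hq, zpow_sub₀ hq, zpow_natCast,
        zpow_one, show (2 * (n : ℤ)) = ((2 * n : ℕ) : ℤ) by push_cast; ring, zpow_natCast]
      field_simp
      ring
  rw [Fin.sum_univ_eq_sum_range (weight N q) N, eq_div_iff hz, h N, two_mul, pow_add]
  field_simp

/-- The weighted partial trace of `R` over its first strand is the scalar `q^N`: the terms `i < j`
telescope to `q^N - q^{N-2j}`, the term `i = j` adds `q^{N-2j}`, and the rest vanish. This is the
source of the factors `A`. -/
theorem sum_weight_mul_rDiag (hq : q ≠ 0) (j : Fin N) :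
    ∑ i : Fin N, weight N q i * rDiag q i j = q ^ N := by
  have h : ∀ n : ℕ, ∑ i ∈ Finset.range n, weight N q i *
      (if i = (j : ℕ) then q else if i < (j : ℕ) then q - q⁻¹ else 0) =
        if n ≤ (j : ℕ) then q ^ N - q ^ N * (q ^ (2 * n))⁻¹ else q ^ N := by
    intro n
    induction n with
    | zero => simp
    | succ n ih =>
      rw [Finset.sum_range_succ, ih, weight, zpow_sub₀ hq, zpow_sub₀ hq, zpow_natCast,
        zpow_one, show (2 * (n : ℤ)) = ((2 * n : ℕ) : ℤ) by push_cast; ring, zpow_natCast]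
      rcases lt_trichotomy n (j : ℕ) with h | h | h
      · rw [if_pos h.le, if_neg h.ne, if_pos h, if_pos (by omega)]
        field_simp
        ring
      · rw [if_pos h.le, if_pos h, if_neg (by omega)]
        field_simp
        ring
      · rw [if_neg (by omega), if_neg (by omega), if_neg (by omega), if_neg (by omega)]
        simp
  have h' := h N
  rw [if_neg (by omega), ← Fin.sum_univ_eq_sum_range (fun i => weight N q i *
      (if i = (j : ℕ) then q else if i < (j : ℕ) then q - q⁻¹ else 0)) N] at h'
  rw [← h']
  simp [rDiag, Fin.ext_iff]

theorem trace_weightCube_mul (M : Matrix ((Fin N × Fin N) × Fin N) ((Fin N × Fin N) × Fin N) K) :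
    Matrix.trace (weightCube N q * M) = ∑ k : Fin N, ∑ j : Fin N, ∑ i : Fin N,
      weight N q i * weight N q j * weight N q k * M ((i, j), k) ((i, j), k) := by
  rw [weightCube_eq, Matrix.trace, Fintype.sum_prod_type_right]
  simp only [Fintype.sum_prod_type_right, Matrix.diag_apply, Matrix.diagonal_mul]

theorem trace_weightCube (hq : q ≠ 0) (hq2 : q ^ 2 ≠ 1) :
    Matrix.trace (weightCube N q * 1) = ((q ^ N - (q ^ N)⁻¹) / (q - q⁻¹)) ^ 3 := by
  rw [trace_weightCube_mul, ← sum_weight hq hq2]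
  simp only [Matrix.one_apply_eq, mul_one, ← Finset.sum_mul, ← Finset.mul_sum]
  ring

theorem rRight_apply_self (i j k : Fin N) :
    rRight N q ((i, j), k) ((i, j), k) = rDiag q j k := by
  have h := rRight_mul_apply (q := q) 1 i j k ((i, j), k)
  rw [mul_one] at h
  rw [h]
  by_cases hjk : j = k
  · simp [hjk]
  · simp [hjk, Ne.symm hjk]

theorem rLeft_mul_rRight_apply_self (i j k : Fin N) :
    (rLeft N q * rRight N q) ((i, j), k) ((i, j), k) = rDiag q i j * rDiag q j k := by
  rw [rLeft_mul_apply, rRight_apply_self]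
  by_cases hij : i = j
  · simp [hij]
  -- The swapped term vanishes: `I ⊗ R` preserves the first index, so it cannot undo the swap of `i
  -- ≠ j`.
  · have h := rRight_mul_apply (q := q) 1 j i k ((i, j), k)
    rw [mul_one] at h
    rw [h]
    simp [hij, Ne.symm hij]

theorem trace_weightCube_mul_rRight (hq : q ≠ 0) (hq2 : q ^ 2 ≠ 1) :
    Matrix.trace (weightCube N q * rRight N q) =
      q ^ N * ((q ^ N - (q ^ N)⁻¹) / (q - q⁻¹)) ^ 2 := by
  rw [trace_weightCube_mul, ← sum_weight hq hq2]
  have h : ∀ i j k : Fin N, weight N q i * weight N q j * weight N q k * rDiag q j k =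
      weight N q i * (weight N q k * (weight N q j * rDiag q j k)) := fun _ _ _ => by ring
  simp only [rRight_apply_self, h, ← Finset.sum_mul, ← Finset.mul_sum, sum_weight_mul_rDiag hq]
  ring

theorem trace_weightCube_mul_rLeft_mul_rRight (hq : q ≠ 0) (hq2 : q ^ 2 ≠ 1) :
    Matrix.trace (weightCube N q * (rLeft N q * rRight N q)) =
      (q ^ N) ^ 2 * ((q ^ N - (q ^ N)⁻¹) / (q - q⁻¹)) := by
  rw [trace_weightCube_mul, ← sum_weight hq hq2]
  -- Strands are closed from the left: the sums over `i` and then `j` each give `q^N`, and the sum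
  -- over `k` remains.
  have h : ∀ i j k : Fin N,
      weight N q i * weight N q j * weight N q k * (rDiag q i j * rDiag q j k) =
      weight N q k * ((weight N q j * rDiag q j k) * (weight N q i * rDiag q i j)) :=
    fun _ _ _ => by ring
  simp only [rLeft_mul_rRight_apply_self, h, ← Finset.sum_mul, ← Finset.mul_sum,
    sum_weight_mul_rDiag hq]
  ring

theorem homflyTrace_eq_characterExpansion [CharZero K] {s : K} (hq : q ≠ 0) (hq2 : q ^ 2 ≠ 1)
    (hq4 : q ^ 4 ≠ 1) (hq6 : q ^ 6 ≠ 1) (hs : s ^ 2 = qNum q 3) (N : ℕ) (L : List (ℤ × ℤ)) :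
    homflyTrace N q L = characterExpansion q s (q ^ N) L := by
  have hA : q ^ N ≠ 0 := pow_ne_zero N hq
  obtain ⟨v1, v2, v3⟩ := reducedExpansion_values hq hq2 hq4 hs hq6 hA
  have h := (isHeckeTrace_rMatrixRep (N := N) hq).ext
    ((isHeckeTrace_reducedExpansion hq hq2 hq4 hs (q ^ N)).smul (schurStar (q ^ N) q [1]))
    (by
      rw [Pi.smul_apply, v1, schurStar_one, map_one, Units.val_one, trace_weightCube hq hq2,
        smul_eq_mul]
      ring)
    (by
      rw [Pi.smul_apply, v2, schurStar_one, rMatrixRep, braidRep_one, smul_eq_mul]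
      exact (trace_weightCube_mul_rRight hq hq2).trans (by ring))
    (by
      rw [Pi.smul_apply, v3, schurStar_one, rMatrixRep, map_mul, braidRep_zero, braidRep_one,
        smul_eq_mul]
      exact (trace_weightCube_mul_rLeft_mul_rRight hq hq2).trans (by ring))
  rw [homflyTrace_eq hq, characterExpansion_eq hq hq2 hq4 hs hq6 hA]
  exact congrFun h (braidOf L)

end RMatrix

/-! ### The table of knots -/

section Table

variable {K : Type*} [Field K] {q s A : K}

/-- The first generator in the reduced Burau representation. -/
def burauLeft (q : K) (hq : q ≠ 0) : (Matrix (Fin 2) (Fin 2) K)ˣ where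
  val := !![q, 1; 0, -q⁻¹]
  inv := !![q⁻¹, 1; 0, -q]
  val_inv := by simp [Matrix.one_fin_two, hq]
  inv_val := by simp [Matrix.one_fin_two, hq]

/-- The second generator in the reduced Burau representation. -/
def burauRight (q : K) (hq : q ≠ 0) : (Matrix (Fin 2) (Fin 2) K)ˣ where
  val := !![-q⁻¹, 0; 1, q]
  inv := !![-q, 0; 1, q⁻¹]
  val_inv := by simp [Matrix.one_fin_two, hq]
  inv_val := by simp [Matrix.one_fin_two, hq]

theorem burau_braid (hq : q ≠ 0) :
    burauLeft q hq * burauRight q hq * burauLeft q hq =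
      burauRight q hq * burauLeft q hq * burauRight q hq := by
  ext i j
  fin_cases i <;> fin_cases j <;> simp [burauLeft, burauRight, hq]

/-- The sector `[21]` can be computed in the reduced Burau representation, whose entries are
Laurent polynomials. -/
theorem coeff21_eq_trace_burau (hq : q ≠ 0) (hq2 : q ^ 2 ≠ 1) (hq4 : q ^ 4 ≠ 1)
    (hs : s ^ 2 = qNum q 3) (L : List (ℤ × ℤ)) :
    coeff21 q s L = Matrix.trace
      (L.map fun p => burauLeft q hq ^ p.1 * burauRight q hq ^ p.2).prod.val := by
  let ρ := braidRep _ _ (burau_braid hq)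
  have hρ : IsHeckeTrace q fun β => Matrix.trace (ρ β).val := by
    refine IsHeckeTrace.of_rep ρ (Matrix.traceLinearMap (Fin 2) K K)
      (fun α β => by simpa using Matrix.trace_mul_comm (ρ α).val _) fun i => ?_
    fin_cases i
    · simp only [ρ, Fin.zero_eta, braidRep_zero]
      change !![q, 1; 0, -q⁻¹] - !![q⁻¹, 1; 0, -q] = _
      ext i j
      fin_cases i <;> fin_cases j <;> simp
      ring
    · simp only [ρ, Fin.mk_one, braidRep_one]
      change !![-q⁻¹, 0; 1, q] - !![-q, 0; 1, q⁻¹] = _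
      ext i j
      fin_cases i <;> fin_cases j <;> simp
      ring
  have h2 := sq_add_one_ne_zero hq4
  -- The traces agree because their three values `2`, `q - q⁻¹`, `-1` do; no intertwiner is
  -- required.
  have h := (isHeckeTrace_rep21 hq hq2 hq4 hs).ext hρ (by simp)
    (by
      have h := trace_rep21_zero_zpow_one hq hq2 hq4 hs 0
      simp only [zpow_zero, one_mul] at h
      rw [h]
      simp only [ρ, braidRep_one, burauRight, Matrix.trace_fin_two]
      simp
      field_simp
      ring)
    (by
      have h := trace_rep21_zero_zpow_one hq hq2 hq4 hs 1
      simp only [zpow_one] at h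
      rw [h, map_mul]
      simp only [ρ, braidRep_one, braidRep_zero, Units.val_mul, burauLeft, burauRight]
      simp [hq]
      field_simp
      ring)
  rw [coeff21_eq_trace_rep21 hq hq2 hq4 hs]
  refine (congrFun h (braidOf L)).trans ?_
  simp only [map_braidOf, ρ, braidRep_zero, braidRep_one]

/-- Over the common denominator `(q² - q⁻²)(q³ - q⁻³)`, the hook-content numerators are expanded in
powers of `A`. The hypotheses compare the coefficients of `A²`, `1`, `A⁻²`, so a row reduces to
identities in `q` alone. -/
theorem characterExpansion_eq_of_coeff [CharZero K] (hq : q ≠ 0) (hq2 : q ^ 2 ≠ 1) (hq4 : q ^ 4 ≠ 1)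
    (hq6 : q ^ 6 ≠ 1) (hA : A ≠ 0) {L : List (ℤ × ℤ)} {h u v w : K} (hh : coeff21 q s L = h)
    (hu : u * ((q ^ 2 - (q ^ 2)⁻¹) * (q ^ 3 - (q ^ 3)⁻¹)) =
      q ^ expSum L * q ^ 3 + (-q⁻¹) ^ expSum L * (q ^ 3)⁻¹ + h * (q + q⁻¹))
    (hv : v * ((q ^ 2 - (q ^ 2)⁻¹) * (q ^ 3 - (q ^ 3)⁻¹)) =
      -(q ^ expSum L + (-q⁻¹) ^ expSum L + h * (q ^ 2 + (q ^ 2)⁻¹)) * (q + q⁻¹))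
    (hw : w * ((q ^ 2 - (q ^ 2)⁻¹) * (q ^ 3 - (q ^ 3)⁻¹)) =
      q ^ expSum L * (q ^ 3)⁻¹ + (-q⁻¹) ^ expSum L * q ^ 3 + h * (q + q⁻¹)) :
    characterExpansion q s A L = schurStar A q [1] * (u * A ^ 2 + v + w * A⁻¹ ^ 2) := by
  have h1 : q ^ 2 - 1 ≠ 0 := sub_ne_zero.2 hq2
  have h2 := sq_add_one_ne_zero hq4
  have h3 := quartic_ne_zero hq6
  have e1 : q - q⁻¹ = (q ^ 2 - 1) / q := by field_simp
  have e2 : q ^ 2 - (q ^ 2)⁻¹ = (q ^ 2 - 1) * (q ^ 2 + 1) / q ^ 2 := by field_simp; ring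
  have e3 : q ^ 3 - (q ^ 3)⁻¹ = (q ^ 2 - 1) * (q ^ 2 * (q ^ 2 + 1) + 1) / q ^ 3 := by
    field_simp; ring
  rw [characterExpansion, hh, schurStar_three hq hq2 hq4 hq6 hA,
    schurStar_one_one_one hq hq2 hq4 hq6 hA, schurStar_two_one hq hq2 hq4 hq6 hA]
  have hd : (q ^ 2 - (q ^ 2)⁻¹) * (q ^ 3 - (q ^ 3)⁻¹) ≠ 0 := by
    rw [e2, e3]
    positivity
  have hd' : (q - q⁻¹) * (q ^ 3 - (q ^ 3)⁻¹) =
      (q ^ 2 - (q ^ 2)⁻¹) * (q ^ 3 - (q ^ 3)⁻¹) / (q + q⁻¹) := by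
    rw [e1, e2, e3]
    field_simp
  rw [← eq_div_iff hd] at hu hv hw
  rw [hd', hu, hv, hw]
  generalize (q ^ 2 - (q ^ 2)⁻¹) * (q ^ 3 - (q ^ 3)⁻¹) = d at hd
  field_simp
  ring

end Table

/-! ### Laurent polynomial identities for the rows of the table -/

section Rows

variable {K : Type*} [Field K] {q s A : K}

theorem burauLeft_inv (hq : q ≠ 0) :
    ((burauLeft q hq)⁻¹ : (Matrix (Fin 2) (Fin 2) K)ˣ).val = !![q⁻¹, 1; 0, -q] := rfl

theorem burauRight_inv (hq : q ≠ 0) :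
    ((burauRight q hq)⁻¹ : (Matrix (Fin 2) (Fin 2) K)ˣ).val = !![-q, 0; 1, q⁻¹] := rfl

/-- Powers are unrolled so that the Burau words become explicit products of `2 × 2` matrices. -/
theorem zpow_three_mul {G : Type*} [Group G] (x : G) : x ^ (3 : ℤ) = x * x * x := by
  rw [zpow_ofNat, pow_succ, pow_two]

theorem zpow_four_mul {G : Type*} [Group G] (x : G) : x ^ (4 : ℤ) = x * x * x * x := by
  rw [zpow_ofNat, pow_succ, pow_succ, pow_two]

theorem zpow_five_mul {G : Type*} [Group G] (x : G) : x ^ (5 : ℤ) = x * x * x * x * x := by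
  rw [zpow_ofNat, pow_succ, pow_succ, pow_succ, pow_two]

theorem palin_nil : palin q [] = 0 := rfl

theorem palin_one (a : ℤ) : palin q [a] = a := by
  simp [palin]

theorem palin_two (a b : ℤ) : palin q [a, b] = a + b * (q ^ 2 + (q ^ 2)⁻¹) := by
  simp [palin]

theorem palin_three (a b c : ℤ) :
    palin q [a, b, c] = a + b * (q ^ 2 + (q ^ 2)⁻¹) + c * (q ^ 4 + (q ^ 4)⁻¹) := by
  simp [palin, Fin.sum_univ_succ, add_assoc]

theorem palin_four (a b c d : ℤ) : palin q [a, b, c, d] =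
    a + b * (q ^ 2 + (q ^ 2)⁻¹) + c * (q ^ 4 + (q ^ 4)⁻¹) + d * (q ^ 6 + (q ^ 6)⁻¹) := by
  simp [palin, Fin.sum_univ_succ, add_assoc]

theorem palin_five (a b c d e : ℤ) : palin q [a, b, c, d, e] =
    a + b * (q ^ 2 + (q ^ 2)⁻¹) + c * (q ^ 4 + (q ^ 4)⁻¹) + d * (q ^ 6 + (q ^ 6)⁻¹) +
      e * (q ^ 8 + (q ^ 8)⁻¹) := by
  simp [palin, Fin.sum_univ_succ, add_assoc]

set_option maxHeartbeats 4000000 in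
theorem trace_burau_knotTable (hq : q ≠ 0) : ∀ r ∈ knotTable, Matrix.trace
    (r.word.map fun p => burauLeft q hq ^ p.1 * burauRight q hq ^ p.2).prod.val =
      palin q r.h21 := by
  simp only [knotTable, List.forall_mem_cons, List.not_mem_nil, false_imp_iff, implies_true,
    and_true]
  refine ⟨?_, ?_, ?_, ?_, ?_, ?_, ?_, ?_, ?_, ?_, ?_, ?_, ?_, ?_, ?_, ?_, ?_, ?_, ?_, ?_, ?_⟩
  all_goals
    simp only [List.map_cons, List.map_nil, List.prod_cons, List.prod_nil, mul_one, zpow_neg,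
      zpow_one, zpow_two, zpow_three_mul, zpow_four_mul, zpow_five_mul, mul_inv_rev, Units.val_mul,
      burauLeft_inv, burauRight_inv]
    simp [burauLeft, burauRight, palin_one, palin_three, palin_four, palin_five, Matrix.trace_fin_two]
    try field_simp
    try ring

set_option maxHeartbeats 4000000 in
theorem zpow_expSum_knotTable (hq : q ≠ 0) : ∀ r ∈ knotTable,
    palin q r.aPos * ((q ^ 2 - (q ^ 2)⁻¹) * (q ^ 3 - (q ^ 3)⁻¹)) =
      q ^ expSum r.word * q ^ 3 + (-q⁻¹) ^ expSum r.word * (q ^ 3)⁻¹ +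
        palin q r.h21 * (q + q⁻¹) ∧
    palin q r.aZero * ((q ^ 2 - (q ^ 2)⁻¹) * (q ^ 3 - (q ^ 3)⁻¹)) =
      -(q ^ expSum r.word + (-q⁻¹) ^ expSum r.word + palin q r.h21 * (q ^ 2 + (q ^ 2)⁻¹)) *
        (q + q⁻¹) ∧
    palin q r.aNeg * ((q ^ 2 - (q ^ 2)⁻¹) * (q ^ 3 - (q ^ 3)⁻¹)) =
      q ^ expSum r.word * (q ^ 3)⁻¹ + (-q⁻¹) ^ expSum r.word * q ^ 3 +
        palin q r.h21 * (q + q⁻¹) := by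
  simp only [knotTable, List.forall_mem_cons, List.not_mem_nil, false_imp_iff, implies_true,
    and_true]
  refine ⟨?_, ?_, ?_, ?_, ?_, ?_, ?_, ?_, ?_, ?_, ?_, ?_, ?_, ?_, ?_, ?_, ?_, ?_, ?_, ?_, ?_⟩
  all_goals
    simp only [expSum, List.map_cons, List.map_nil, List.sum_cons, List.sum_nil]
    norm_num only [palin_one, palin_two, palin_three, palin_four, palin_five, palin_nil, zpow_neg,
      zpow_ofNat, Int.cast_neg, Int.cast_ofNat, Int.cast_one, Int.cast_zero]
    refine ⟨?_, ?_, ?_⟩ <;> field_simp <;> ring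

end Rows

end ThreeStrand

theorem mainTheorem2 {K : Type*} [Field K] [CharZero K] (q s : K) (hq : q ≠ 0)
    (hq2 : q ^ 2 ≠ 1) (hq4 : q ^ 4 ≠ 1) (hq6 : q ^ 6 ≠ 1)
    (hs : s ^ 2 = ThreeStrand.qNum q 3) :
    -- `U` is orthogonal, and it is the mixing matrix of the two fusion bases in the sector `[21]`
    ThreeStrand.mixing q s * (ThreeStrand.mixing q s)ᵀ = 1 ∧
    ThreeStrand.IsMixingMatrix q (ThreeStrand.mixing q s) ∧
    -- the weighted trace of `R`-matrices, `A = q^N`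
    (∀ (N : ℕ), 1 ≤ N → ∀ L : List (ℤ × ℤ),
      ThreeStrand.homflyTrace N q L = ThreeStrand.characterExpansion q s (q ^ N) L) ∧
    -- the HOMFLY polynomial of the closed braid, generic `A`
    (∀ A : K, A ≠ 0 →
      (∃ P, ThreeStrand.IsHomfly A q 3 P) ∧
      ∀ (M : ℕ∞), 3 ≤ M → ∀ P, ThreeStrand.IsHomfly A q M P → ∀ L : List (ℤ × ℤ),
        A ^ ThreeStrand.expSum L * ThreeStrand.schurStar A q [1] *
            P 2 (ThreeStrand.braidOf L) =
          ThreeStrand.characterExpansion q s A L) ∧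
    -- the table of 3-strand knots
    (∀ r ∈ ThreeStrand.knotTable,
      ThreeStrand.coeff21 q s r.word = ThreeStrand.palin q r.h21 ∧
      ∀ A : K, A ≠ 0 →
        ThreeStrand.characterExpansion q s A r.word =
          ThreeStrand.schurStar A q [1] *
            (ThreeStrand.palin q r.aPos * A ^ 2 + ThreeStrand.palin q r.aZero +
              ThreeStrand.palin q r.aNeg * A⁻¹ ^ 2)) := by
  refine ⟨ThreeStrand.mixing_mul_transpose hq hq2 hq4 hs,
    ThreeStrand.isMixingMatrix_mixing hq hq2 hq4 hq6 hs, fun N _ L =>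
    ThreeStrand.homflyTrace_eq_characterExpansion hq hq2 hq4 hq6 hs N L, fun A hA =>
    ⟨⟨_, ThreeStrand.isHomfly_homflyThree hq hq2 hq4 hs hq6 hA⟩, fun M hM P hP L => ?_⟩,
    fun r hr => ?_⟩
  · rw [ThreeStrand.characterExpansion_eq hq hq2 hq4 hs hq6 hA,
      ← hP.eq_reducedExpansion hq hq2 hq4 hs hq6 hA hM L]
    ring
  · have hc := (ThreeStrand.coeff21_eq_trace_burau hq hq2 hq4 hs r.word).trans
      (ThreeStrand.trace_burau_knotTable hq r hr)
    obtain ⟨hu, hv, hw⟩ := ThreeStrand.zpow_expSum_knotTable hq r hr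
    exact ⟨hc, fun A hA =>
      ThreeStrand.characterExpansion_eq_of_coeff hq hq2 hq4 hq6 hA hc hu hv hw⟩
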